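/- For a knot $K$ with Seifert matrix $V$ (of even size $2g$), let $\Delta(K)(t)=\det(t^{1/2}V-t^{-1/2}V^T)=t^{-g}\det(tV-V^T)$ be its symmetrized Alexander polynomial, and for $t\in S^1=\{|t|=1\}$ let $\sigma_t(K)$ be the signature (number of positive minus number of negative eigenvalues) of the Hermitian matrix $(1-t)V+(1-\bar t)V^T$. For a root $\rho=e^{i\theta}$ of $\Delta(K)$ on $S^1$ define the jump $$\mathrm{j}_\rho(K)=\lim_{\varphi\to\theta^+}\sigma_{e^{i\varphi}}(K)-\lim_{\varphi\to\theta^-}\sigma_{e^{i\varphi}}(K).$$ For a real analytic function $f$ near $a\in\mathbb R$, let $\operatorname{sgn}(f,a)$ be the sign of the first nonvanishing Taylor coefficient of $f$ at $a$ (and $0$ if there is none); write $\operatorname{sgn}(\Delta(K),\theta)$ for $\operatorname{sgn}(f,\theta)$ with $f(\varphi)=\Delta(K)(e^{i\varphi})$, which is real-valued. **Theorem.** Let $K$ be a knot such that all roots of $\Delta(K)$ on the unit circle are simple, and let $\rho=e^{i\theta}$ be a root of $\Delta(K)$ on the unit circle. Choose a planar projection of $K$ and a crossing of it, let $\epsilon\in\{+1,-1\}$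 be the sign of this crossing, and let $K^+$ and $K^-$ be the knots obtained by making this crossing positive, respectively negative (so that $K=K^{\epsilon}$). Suppose that $\Delta(K^{-\epsilon})(\rho)\neq 0$. Then both one-sided limits of the signature function at $\rho$ exist and $$\mathrm{j}_\rho(K)=2\,\epsilon\,\operatorname{sgn}(\Delta(K^+),\theta)\,\operatorname{sgn}(\Delta(K^-),\theta)\in\{-2,2\}.$$ -/

import Mathlib

open Filter Topology

noncomputable section

/-! ### Oriented knot diagrams -/

/-- The underlying oriented curve of a diagram, with `n` double points.

Rotate the picture at a double point `c` so that both strands run upwards.  The curve then passes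
through `c` twice: the passage `(c, true)` runs from bottom left to top right, the passage
`(c, false)` from bottom right to top left.  `next p` is the passage met immediately after `p` when
one travels along the curve.  The edge of the curve that starts at the passage `p` (and ends at
`next p`) is also called `p`. -/
structure OrientedShadow where
  n : ℕ
  next : Equiv.Perm (Fin n × Bool)

namespace OrientedShadow

variable (S : OrientedShadow)

/-- The edges of the curve, each named by the passage at which it starts. -/
abbrev Edge : Type := Fin S.n × Bool

/-- The edge that arrives at `c` from the bottom left. -/
def inL (c : Fin S.n) : S.Edge := S.next.symm (c, true)

/-- The edge that arrives at `c` from the bottom right. -/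
def inR (c : Fin S.n) : S.Edge := S.next.symm (c, false)

/-- The edge that leaves `c` to the top left. -/
def outL (c : Fin S.n) : S.Edge := (c, false)

/-- The edge that leaves `c` to the top right. -/
def outR (c : Fin S.n) : S.Edge := (c, true)

/-- `(e, true)` is the left side of the edge `e`, and `(e, false)` its right side.  Each of the four
corners at a double point belongs to one region and glues two sides of edges. -/
inductive Corner : S.Edge × Bool → S.Edge × Bool → Prop
  | west (c : Fin S.n) : Corner (S.inL c, true) (S.outL c, true)
  | north (c : Fin S.n) : Corner (S.outL c, false) (S.outR c, true)
  | east (c : Fin S.n) : Corner (S.outR c, false) (S.inR c, false)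
  | south (c : Fin S.n) : Corner (S.inR c, true) (S.inL c, false)

/-- The regions (faces) of the curve: sides of edges, glued at the corners. -/
def Region : Type := Quot S.Corner

end OrientedShadow

/-- A diagram (a regular planar projection with crossing information) of an oriented knot, with at
least one crossing.

* `single`: the curve has a single component.
* `planar`: the 4-valent graph with `n` vertices and `2 n` edges lies on the sphere, that is, it has
  `n + 2` regions (Euler's formula; the surface given by the code is connected by `single`).
* `sign c` is the sign of the crossing `c`.  With both strands running upwards, the over-strand of a
  positive crossing runs from bottom left to top right, and the over-strand of a negative crossing
  runs from bottom right to top left.  So the sign also says which passage is the upper one. -/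
structure KnotDiagram extends OrientedShadow where
  single : ∀ p q : Fin n × Bool, next.SameCycle p q
  planar : Nat.card toOrientedShadow.Region = n + 2
  sign : Fin n → ℤˣ

namespace KnotDiagram

variable (D : KnotDiagram)

/-- The diagram `K^δ` obtained by making the crossing `c` positive (`δ = 1`) or negative
(`δ = -1`). -/
def resolve (c : Fin D.n) (δ : ℤˣ) : KnotDiagram where
  toOrientedShadow := D.toOrientedShadow
  single := D.single
  planar := D.planar
  sign := Function.update D.sign c δ

/-! ### The Seifert surface of a diagram

Smoothing all crossings along the orientation turns the diagram into the disjoint Seifert circles: at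
`c` the edge `inL c` is continued by `outL c`, and `inR c` by `outR c`.  The Seifert surface consists
of a disc for each Seifert circle and a half-twisted band for each crossing.  When every band is
contracted to a point, the surface becomes the graph of the curve with a 2-cell glued to each Seifert
circle, so its first homology is that of this 2-complex. -/

/-- Cellular 1-cycles: integral flows on the edges that are conserved at each crossing. -/
def cycles : Submodule ℤ (D.Edge → ℤ) where
  carrier := {x | ∀ c, x (D.outL c) + x (D.outR c) = x (D.inL c) + x (D.inR c)}
  zero_mem' := by intro c; simp
  add_mem' := by
    intro x y hx hy c
    have h1 := hx c
    have h2 := hy c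
    simp only [Pi.add_apply]
    linarith
  smul_mem' := by
    intro a x hx c
    have h1 := hx c
    simp only [Pi.smul_apply, smul_eq_mul]
    rw [← mul_add, ← mul_add, h1]

/-- The amount of a cycle that runs through the band at each crossing, from the right to the left
Seifert arc. -/
def bandFlow : D.cycles →ₗ[ℤ] (Fin D.n → ℤ) where
  toFun x c := x.1 (D.outL c) - x.1 (D.inL c)
  map_add' := by
    intro x y
    funext c
    simp only [Submodule.coe_add, Pi.add_apply]
    ring
  map_smul' := by
    intro a x
    funext c
    simp only [Submodule.coe_smul, Pi.smul_apply, smul_eq_mul, RingHom.id_apply]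
    ring

/-- The boundaries: the cycles that are constant along each Seifert circle, i.e. the integral
combinations of Seifert circles. -/
def discBoundaries : Submodule ℤ D.cycles := LinearMap.ker D.bandFlow

/-- The first homology group of the Seifert surface. -/
abbrev SeifertH1 : Type := D.cycles ⧸ D.discBoundaries

/-- The linking number `lk(x, y⁺)`, where `y⁺` is `y` pushed off the Seifert surface in the positive
normal direction.

Let the discs be domes standing on the Seifert circles, the outer ones above the inner ones, so that
the surface is a vertical wall over each edge and the bands hang below.  Near the edges the positive
normal points to the right of the edge, so the projections of `x` and `y⁺` meet only at the bands.  At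
a band `x` passes over `y⁺` exactly once, with `x` travelling upwards on the right Seifert arc and
`y⁺` through the band from right to left; this is a positive crossing.  The half-twist puts this
crossing above the end of the band if the crossing of the diagram is positive and below it if it is
negative, so that the arc of `x` involved is `outR c` or `inR c`, respectively. -/
def linking (x y : D.cycles) : ℤ :=
  ∑ c, (if D.sign c = 1 then x.1 (D.outR c) else x.1 (D.inR c)) * D.bandFlow y c

/-- `V` is the matrix `lk(bᵢ, bⱼ⁺)` of the Seifert surface of the diagram for a basis `b` of its first
homology. -/
def IsDiagramSeifertMatrix {m : ℕ} (V : Matrix (Fin m) (Fin m) ℤ) : Prop :=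
  ∃ (b : Module.Basis (Fin m) ℤ D.SeifertH1) (x : Fin m → D.cycles),
    (∀ i, D.discBoundaries.mkQ (x i) = b i) ∧ ∀ i j, V i j = D.linking (x i) (x j)

end KnotDiagram

/-! ### Seifert matrices of a knot -/

/-- The elementary enlargement `[[V, v, 0], [0, 0, 1], [0, 0, 0]]`. -/
def enlargeCol {m : ℕ} (V : Matrix (Fin m) (Fin m) ℤ) (v : Fin m → ℤ) :
    Matrix (Fin (m + 2)) (Fin (m + 2)) ℤ :=
  Matrix.reindex finSumFinEquiv finSumFinEquiv
    (Matrix.fromBlocks V (Matrix.of fun i j => if j = 0 then v i else 0) 0 !![0, 1; 0, 0])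

/-- The elementary enlargement `[[V, 0, 0], [v, 0, 0], [0, 1, 0]]`. -/
def enlargeRow {m : ℕ} (V : Matrix (Fin m) (Fin m) ℤ) (v : Fin m → ℤ) :
    Matrix (Fin (m + 2)) (Fin (m + 2)) ℤ :=
  Matrix.reindex finSumFinEquiv finSumFinEquiv
    (Matrix.fromBlocks V 0 (Matrix.of fun i j => if i = 0 then v j else 0) !![0, 0; 1, 0])

/-- S-equivalence of integral matrices: the equivalence relation generated by unimodular congruence
and elementary enlargements. -/
inductive SEquivalent : ∀ {m k : ℕ}, Matrix (Fin m) (Fin m) ℤ → Matrix (Fin k) (Fin k) ℤ → Prop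
  | congruent {m : ℕ} (V P : Matrix (Fin m) (Fin m) ℤ) (hP : IsUnit P.det) :
      SEquivalent V (P.transpose * V * P)
  | col {m : ℕ} (V : Matrix (Fin m) (Fin m) ℤ) (v : Fin m → ℤ) : SEquivalent V (enlargeCol V v)
  | row {m : ℕ} (V : Matrix (Fin m) (Fin m) ℤ) (v : Fin m → ℤ) : SEquivalent V (enlargeRow V v)
  | symm {m k : ℕ} {V : Matrix (Fin m) (Fin m) ℤ} {W : Matrix (Fin k) (Fin k) ℤ} :
      SEquivalent V W → SEquivalent W V
  | trans {m k l : ℕ} {V : Matrix (Fin m) (Fin m) ℤ} {W : Matrix (Fin k) (Fin k) ℤ}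
      {U : Matrix (Fin l) (Fin l) ℤ} : SEquivalent V W → SEquivalent W U → SEquivalent V U

/-- `V` is a Seifert matrix of the knot with diagram `D`.  Seifert matrices of a knot, from whatever
Seifert surface, are S-equivalent to each other; so every matrix in the S-equivalence class of the
Seifert matrices of the diagram is admitted. -/
def KnotDiagram.IsSeifertMatrix (D : KnotDiagram) {m : ℕ} (V : Matrix (Fin m) (Fin m) ℤ) : Prop :=
  ∃ (k : ℕ) (V₀ : Matrix (Fin k) (Fin k) ℤ), D.IsDiagramSeifertMatrix V₀ ∧ SEquivalent V₀ V

/-- Every knot diagram has a Seifert matrix. -/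
theorem KnotDiagram.exists_isSeifertMatrix (D : KnotDiagram) :
    ∃ (m : ℕ) (V : Matrix (Fin m) (Fin m) ℤ), D.IsSeifertMatrix V := by
  have e : D.SeifertH1 ≃ₗ[ℤ] LinearMap.range D.bandFlow := D.bandFlow.quotKerEquivRange
  obtain ⟨m, b⟩ := Submodule.basisOfPid (Pi.basisFun ℤ (Fin D.n)) (LinearMap.range D.bandFlow)
  let b' : Module.Basis (Fin m) ℤ D.SeifertH1 := b.map e.symm
  choose x hx using fun i => D.discBoundaries.mkQ_surjective (b' i)
  let V : Matrix (Fin m) (Fin m) ℤ := Matrix.of fun i j => D.linking (x i) (x j)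
  refine ⟨m, V, m, V, ⟨b', x, hx, fun i j => rfl⟩, ?_⟩
  have h := SEquivalent.congruent V 1 (by simp)
  simpa using h

/-! ### Alexander polynomial, signature function and jumps -/

open Polynomial in
/-- `det (t V - Vᵀ)`, the Alexander polynomial up to a power of `t`. -/
def alexanderPoly {m : ℕ} (V : Matrix (Fin m) (Fin m) ℤ) : ℤ[X] :=
  ((X : ℤ[X]) • V.map (C : ℤ → ℤ[X]) - (V.map (C : ℤ → ℤ[X])).transpose).det

/-- The value at `t ≠ 0` of the symmetrized Alexander polynomial
`det (t^(1/2) V - t^(-1/2) Vᵀ) = t^(-m/2) det (t V - Vᵀ)`; the size `m` of a Seifert matrix of a knot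
is even. -/
def alexander {m : ℕ} (V : Matrix (Fin m) (Fin m) ℤ) (t : ℂ) : ℂ :=
  t ^ (-((m / 2 : ℕ) : ℤ)) * Polynomial.aeval t (alexanderPoly V)

/-- The Alexander polynomial has only simple roots on the unit circle. -/
def HasSimpleCircleRoots {m : ℕ} (V : Matrix (Fin m) (Fin m) ℤ) : Prop :=
  ∀ ρ : ℂ, ‖ρ‖ = 1 → Polynomial.aeval ρ (alexanderPoly V) = 0 →
    Polynomial.aeval ρ (Polynomial.derivative (alexanderPoly V)) ≠ 0

/-- The matrix `B(t) = (1 - t) V + (1 - t̄) Vᵀ`. -/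
def hermitianForm {m : ℕ} (V : Matrix (Fin m) (Fin m) ℤ) (t : ℂ) : Matrix (Fin m) (Fin m) ℂ :=
  (1 - t) • V.map (Int.cast : ℤ → ℂ) + (1 - star t) • (V.map (Int.cast : ℤ → ℂ)).transpose

theorem hermitianForm_isHermitian {m : ℕ} (V : Matrix (Fin m) (Fin m) ℤ) (t : ℂ) :
    (hermitianForm V t).IsHermitian := by
  ext i j
  simp [hermitianForm, Matrix.conjTranspose_apply, add_comm]

/-- The signature of `B(t)`: the number of positive minus the number of negative eigenvalues. -/
def signatureAt {m : ℕ} (V : Matrix (Fin m) (Fin m) ℤ) (t : ℂ) : ℤ :=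
  ∑ i, (SignType.sign ((hermitianForm_isHermitian V t).eigenvalues i) : ℤ)

/-- The point `e^{iθ}` of the unit circle. -/
def circlePoint (θ : ℝ) : ℂ := Complex.exp (θ * Complex.I)

/-- The integer-valued function `σ` on the unit circle has one-sided limits at `e^{iθ}`, and `j` is
the limit for arguments decreasing to `θ` minus the limit for arguments increasing to `θ`. -/
def HasJump (σ : ℂ → ℤ) (θ : ℝ) (j : ℤ) : Prop :=
  ∃ a b : ℤ, Tendsto (fun φ : ℝ => σ (circlePoint φ)) (𝓝[>] θ) (𝓝 a) ∧
    Tendsto (fun φ : ℝ => σ (circlePoint φ)) (𝓝[<] θ) (𝓝 b) ∧ j = a - b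

open Classical in
/-- The sign of an analytic function `f` at `a`: the sign of its first nonzero Taylor coefficient at
`a`, and zero if there is none. -/
def sgnAt (f : ℝ → ℝ) (a : ℝ) : ℤ :=
  if h : ∃ k : ℕ, iteratedDeriv k f a ≠ 0 then
    (SignType.sign (iteratedDeriv (Nat.find h) f a) : ℤ)
  else 0

/-- The sign at `θ` of `Δ(e^{iφ})` as a function of the real variable `φ`.  The symmetrized Alexander
polynomial is real on the unit circle, so that the real part is the value itself. -/
def alexanderSgn {m : ℕ} (V : Matrix (Fin m) (Fin m) ℤ) (θ : ℝ) : ℤ :=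
  sgnAt (fun φ : ℝ => (alexander V (circlePoint φ)).re) θ

end

/-!
Changing the crossing `c` replaces the Seifert matrix `V` of the diagram by `U = V + ε f fᵀ`, where
`f` records how often each basis cycle runs through the band at `c`.  Hence on the unit circle
`B_U(t) = B_V(t) + ε |1 - t|² f f*` is a rank-one perturbation, and the two signatures differ by
`0` or `2ε` according to whether the determinants of `B_V(t)` and `B_U(t)` have the same sign.  Both
determinants are the Alexander polynomials times the same real factor, so
`σ_t(U) - σ_t(V) = ε (1 - sign Δ_V(t) sign Δ_U(t))` away from the roots.  Near `ρ` the signature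
`σ_t(U)` and the sign of `Δ_U(t)` are constant, whereas `Δ_V` changes sign, since its order at `ρ`
is odd; the jump of `σ_t(V)` can be read off.

The formula fails at `t = 1`, where `B` vanishes.  But `Δ(t⁻¹) = Δ(t)` makes the order at `1` even,
so `ρ ≠ 1`.  The symmetry requires `V` to have even size, which follows from a count of Seifert
circles: smoothing each crossing multiplies the permutation of the edges by a transposition.
-/

noncomputable section

open Matrix
open scoped Finset

/-! ### Signatures of Hermitian matrices -/

section Signature

theorem sigPos_le_sigPos_add_finrank {E F : Type*} [AddCommGroup E] [Module ℝ E]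
    [FiniteDimensional ℝ E] [AddCommGroup F] [Module ℝ F] [FiniteDimensional ℝ F]
    {Q R : QuadraticForm ℝ E} (f : E →ₗ[ℝ] F) (h : ∀ x, f x = 0 → Q x ≤ R x) :
    sigPos Q ≤ sigPos R + Module.finrank ℝ F := by
  obtain ⟨P, hP, hpos⟩ := exists_finrank_eq_sigPos_and_posDef Q
  set N := (LinearMap.ker (f.domRestrict P)).map P.subtype
  have hN : (R.restrict N).PosDef := by
    rintro ⟨_, x, hx, rfl⟩ hx0
    exact (hpos x (by simpa using hx0)).trans_le (h x hx)
  have hdim := (f.domRestrict P).finrank_range_add_finrank_ker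
  have hrange := Submodule.finrank_le (LinearMap.range (f.domRestrict P))
  have hle := le_sigPos_of_posDef R hN
  rw [Submodule.finrank_map_subtype_eq] at hle
  omega

variable {ι κ : Type*} [Fintype ι] [Fintype κ]

/-- The real quadratic form `x ↦ Re (x* A x)` of a complex matrix, whose inertia is twice that of
`A` when `A` is Hermitian. -/
def reForm (A : Matrix ι ι ℂ) : QuadraticForm ℝ (ι → ℂ) :=
  LinearMap.BilinMap.toQuadraticMap <|
    LinearMap.mk₂ ℝ (fun x y => (star x ⬝ᵥ A *ᵥ y).re)
      (fun x y z => by simp only [star_add, add_dotProduct, Complex.add_re])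
      (fun c x y => by simp only [star_smul, star_trivial, smul_dotProduct, Complex.smul_re])
      (fun x y z => by simp only [mulVec_add, dotProduct_add, Complex.add_re])
      (fun c x y => by simp only [mulVec_smul, dotProduct_smul, Complex.smul_re])

theorem reForm_apply (A : Matrix ι ι ℂ) (x : ι → ℂ) : reForm A x = (star x ⬝ᵥ A *ᵥ x).re := rfl

theorem reForm_neg (A : Matrix ι ι ℂ) : reForm (-A) = -reForm A := by
  ext x
  simp [reForm_apply, neg_mulVec]

theorem reForm_add_smul_vecMulVec (A : Matrix ι ι ℂ) (s : ℝ) (a x : ι → ℂ) :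
    reForm (A + (s : ℂ) • vecMulVec a (star a)) x = reForm A x + s * ‖star a ⬝ᵥ x‖ ^ 2 := by
  have h : (star a ⬝ᵥ x) * (star x ⬝ᵥ a) = ((‖star a ⬝ᵥ x‖ ^ 2 : ℝ) : ℂ) := by
    rw [star_dotProduct x, Complex.star_def, Complex.mul_conj']
    norm_cast
  rw [reForm_apply, reForm_apply, add_mulVec, dotProduct_add, Complex.add_re, smul_mulVec,
    vecMulVec_mulVec, dotProduct_smul, dotProduct_smul, op_smul_eq_smul, smul_eq_mul, smul_eq_mul,
    h, ← Complex.ofReal_mul, Complex.ofReal_re]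

theorem eventually_sigPos_reForm_le {X : Type*} [TopologicalSpace X] {M : X → Matrix ι ι ℂ}
    {a : X} (hM : ContinuousAt M a) :
    ∀ᶠ t in 𝓝 a, sigPos (reForm (M a)) ≤ sigPos (reForm (M t)) := by
  obtain ⟨E, hE, hpos⟩ := exists_finrank_eq_sigPos_and_posDef (reForm (M a))
  have hcompact : IsCompact (Metric.sphere 0 1 ∩ (E : Set (ι → ℂ))) :=
    (isCompact_sphere 0 1).inter_right E.closed_of_finiteDimensional
  have hcont : ∀ x : ι → ℂ, ContinuousAt (fun z : X × (ι → ℂ) => reForm (M z.1) z.2) (a, x) := by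
    intro x
    have hMx : ContinuousAt (fun z : X × (ι → ℂ) => M z.1) (a, x) := hM.comp continuousAt_fst
    have hform : Continuous fun w : Matrix ι ι ℂ × (ι → ℂ) => (star w.2 ⬝ᵥ w.1 *ᵥ w.2).re := by
      fun_prop
    simp only [reForm_apply]
    exact ContinuousAt.comp (f := fun z : X × (ι → ℂ) => (M z.1, z.2)) hform.continuousAt
      (hMx.prodMk continuousAt_snd)
  have hsphere : ∀ᶠ t in 𝓝 a, ∀ x ∈ Metric.sphere 0 1 ∩ (E : Set (ι → ℂ)), 0 < reForm (M t) x :=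
    hcompact.eventually_forall_of_forall_eventually fun x hx =>
      (hcont x).eventually_const_lt (hpos ⟨x, hx.2⟩ fun h =>
        Metric.ne_of_mem_sphere hx.1 one_ne_zero (congrArg Subtype.val h))
  filter_upwards [hsphere] with t ht
  rw [← hE]
  refine le_sigPos_of_posDef _ fun x hx => ?_
  have hx' : (x : ι → ℂ) ≠ 0 := by simpa using hx
  have hunit := ht (‖(x : ι → ℂ)‖⁻¹ • (x : ι → ℂ))
    ⟨by simp [norm_smul, hx'], E.smul_mem _ x.2⟩
  rw [QuadraticMap.map_smul] at hunit
  exact pos_of_mul_pos_right hunit (mul_self_nonneg _)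

theorem reForm_conjTranspose_mul_mul_equivalent [DecidableEq ι] (A : Matrix ι ι ℂ)
    {P : Matrix ι ι ℂ} (hP : IsUnit P) : (reForm (Pᴴ * A * P)).Equivalent (reForm A) := by
  obtain ⟨u, rfl⟩ := hP
  refine ⟨⟨(Matrix.toLinearEquiv' (u : Matrix ι ι ℂ) u.invertible).restrictScalars ℝ, fun x => ?_⟩⟩
  change (reForm A) ((u : Matrix ι ι ℂ) *ᵥ x) = _
  rw [reForm_apply, reForm_apply, star_mulVec, ← dotProduct_mulVec, mulVec_mulVec, mulVec_mulVec]

theorem reForm_diagonal_equivalent [DecidableEq ι] (w : ι → ℝ) :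
    (reForm (diagonal fun i => (w i : ℂ))).Equivalent
      (QuadraticMap.weightedSumSquares ℝ fun p : Σ _ : ι, Fin 2 => w p.1) := by
  refine ⟨⟨(Pi.basis fun _ : ι => Complex.basisOneI).equivFun, fun x => ?_⟩⟩
  change QuadraticMap.weightedSumSquares ℝ (fun p : Σ _ : ι, Fin 2 => w p.1)
    ((Pi.basis fun _ : ι => Complex.basisOneI).equivFun x) = _
  simp only [QuadraticMap.weightedSumSquares_apply, Fintype.sum_sigma, reForm_apply,
    Module.Basis.equivFun_apply, Pi.basis_repr, Fin.sum_univ_two, dotProduct, mulVec_diagonal,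
    Complex.re_sum]
  refine Finset.sum_congr rfl fun i _ => ?_
  simp
  ring

theorem sum_sign_eq_card_sub_card (w : ι → ℝ) :
    ∑ i, (SignType.sign (w i) : ℤ) = #{i | 0 < w i} - #{i | w i < 0} := by
  simp only [Finset.card_filter, Nat.cast_sum, ← Finset.sum_sub_distrib]
  refine Finset.sum_congr rfl fun i _ => ?_
  rcases lt_trichotomy (w i) 0 with hi | hi | hi <;> simp [hi, hi.not_gt]

theorem ncard_sigma_fin_two (p : ι → Prop) [DecidablePred p] :
    {q : Σ _ : ι, Fin 2 | p q.1}.ncard = 2 * #{i | p i} := by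
  have : {q : Σ _ : ι, Fin 2 | p q.1} =
      (({i | p i} : Finset ι).sigma fun _ => (Finset.univ : Finset (Fin 2))) := by
    ext; simp
  rw [this, Set.ncard_coe_finset, Finset.card_sigma]
  simp [mul_comm]

variable [DecidableEq ι] [DecidableEq κ] {A B : Matrix ι ι ℂ} {C : Matrix κ κ ℂ}

/-- The number of positive minus the number of negative eigenvalues. -/
def hermSignature (hA : A.IsHermitian) : ℤ := ∑ i, (SignType.sign (hA.eigenvalues i) : ℤ)

/-- The number of positive eigenvalues. -/
def posIndex (hA : A.IsHermitian) : ℕ := #{i | 0 < hA.eigenvalues i}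

/-- The number of negative eigenvalues. -/
def negIndex (hA : A.IsHermitian) : ℕ := #{i | hA.eigenvalues i < 0}

theorem hermSignature_eq_posIndex_sub_negIndex (hA : A.IsHermitian) :
    hermSignature hA = posIndex hA - negIndex hA :=
  sum_sign_eq_card_sub_card _

theorem reForm_equivalent_eigenvalues (hA : A.IsHermitian) :
    (reForm A).Equivalent
      (QuadraticMap.weightedSumSquares ℝ fun p : Σ _ : ι, Fin 2 => hA.eigenvalues p.1) := by
  have hU : (star hA.eigenvectorUnitary : Matrix ι ι ℂ)ᴴ *
      diagonal (fun i => (hA.eigenvalues i : ℂ)) *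
      (star hA.eigenvectorUnitary : Matrix ι ι ℂ) = A := by
    conv_rhs => rw [hA.spectral_theorem, Unitary.conjStarAlgAut_apply]
    rw [star_eq_conjTranspose, conjTranspose_conjTranspose]
    rfl
  have := reForm_conjTranspose_mul_mul_equivalent (diagonal fun i => (hA.eigenvalues i : ℂ))
    (Unitary.toUnits (star hA.eigenvectorUnitary)).isUnit
  exact (hU ▸ this).trans (reForm_diagonal_equivalent _)

theorem sigPos_reForm (hA : A.IsHermitian) : sigPos (reForm A) = 2 * posIndex hA := by
  rw [QuadraticForm.sigPos_of_equiv_weightedSumSquares (reForm_equivalent_eigenvalues hA)]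
  exact ncard_sigma_fin_two fun i => 0 < hA.eigenvalues i

theorem sigNeg_reForm (hA : A.IsHermitian) : sigNeg (reForm A) = 2 * negIndex hA := by
  rw [QuadraticForm.sigNeg_of_equiv_weightedSumSquares (reForm_equivalent_eigenvalues hA)]
  exact ncard_sigma_fin_two fun i => hA.eigenvalues i < 0

theorem posIndex_add_negIndex_le (hA : A.IsHermitian) :
    posIndex hA + negIndex hA ≤ Fintype.card ι := by
  rw [posIndex, negIndex, ← Finset.card_union_of_disjoint]
  · exact Finset.card_le_univ _
  · exact Finset.disjoint_filter.2 fun i _ hi => hi.not_gt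

theorem eigenvalues_ne_zero (hA : A.IsHermitian) (hd : A.det ≠ 0) (i : ι) :
    hA.eigenvalues i ≠ 0 := fun h => hd <| by
  rw [hA.det_eq_prod_eigenvalues]
  exact Finset.prod_eq_zero (Finset.mem_univ i) (by simp [h])

theorem posIndex_add_negIndex (hA : A.IsHermitian) (hd : A.det ≠ 0) :
    posIndex hA + negIndex hA = Fintype.card ι := by
  rw [posIndex, negIndex, ← Finset.card_union_of_disjoint, ← Finset.filter_or,
    Finset.filter_true_of_mem, Finset.card_univ]
  · exact fun i _ => (eigenvalues_ne_zero hA hd i).lt_or_gt.symm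
  · exact Finset.disjoint_filter.2 fun i _ hi => hi.not_gt

theorem sign_det_re (hA : A.IsHermitian) (hd : A.det ≠ 0) :
    (SignType.sign A.det.re : ℤ) = (-1) ^ negIndex hA := by
  have hdet : A.det.re = ∏ i, hA.eigenvalues i := by
    rw [hA.det_eq_prod_eigenvalues]
    exact (congrArg Complex.re (Complex.ofReal_prod ..).symm).trans (Complex.ofReal_re _)
  have hsign : ∀ i, SignType.sign (hA.eigenvalues i) = if hA.eigenvalues i < 0 then -1 else 1 := by
    intro i
    rcases (eigenvalues_ne_zero hA hd i).lt_or_gt with hi | hi <;> simp [hi, hi.not_gt]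
  rw [hdet, ← signHom_apply, map_prod]
  simp only [signHom_apply, hsign, Finset.prod_ite, Finset.prod_const, one_pow, mul_one]
  simp [negIndex, SignType.coe_pow]

theorem hermSignature_eq_of_equivalent (hA : A.IsHermitian) (hC : C.IsHermitian)
    (h : (reForm A).Equivalent (reForm C)) : hermSignature hA = hermSignature hC := by
  have hpos := h.sigPos_eq
  have hneg := h.sigNeg_eq
  rw [sigPos_reForm hA, sigPos_reForm hC] at hpos
  rw [sigNeg_reForm hA, sigNeg_reForm hC] at hneg
  rw [hermSignature_eq_posIndex_sub_negIndex, hermSignature_eq_posIndex_sub_negIndex]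
  omega

theorem hermSignature_eq_sum_roots (hA : A.IsHermitian) :
    hermSignature hA = (A.charpoly.roots.map fun z => (SignType.sign z.re : ℤ)).sum := by
  rw [hA.roots_charpoly_eq_eigenvalues, Multiset.map_map]
  simp [hermSignature]

theorem hermSignature_eq_of_charpoly_eq (hA : A.IsHermitian) (hC : C.IsHermitian)
    (h : A.charpoly = C.charpoly) : hermSignature hA = hermSignature hC := by
  rw [hermSignature_eq_sum_roots, hermSignature_eq_sum_roots, h]

theorem hermSignature_fromBlocks_zero (hA : A.IsHermitian) (hC : C.IsHermitian)
    (h : (fromBlocks A 0 0 C).IsHermitian) :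
    hermSignature h = hermSignature hA + hermSignature hC := by
  simp only [hermSignature_eq_sum_roots, charpoly_fromBlocks_zero₁₂]
  rw [Polynomial.roots_mul (mul_ne_zero A.charpoly_monic.ne_zero C.charpoly_monic.ne_zero),
    Multiset.map_add, Multiset.sum_add]

theorem hermSignature_fromBlocks (hC : C.IsHermitian) (hdet : IsUnit C.det)
    (E : Matrix ι κ ℂ) (h : (fromBlocks A E Eᴴ C).IsHermitian)
    (hS : (A - E * C⁻¹ * Eᴴ).IsHermitian) :
    hermSignature h = hermSignature hS + hermSignature hC := by
  have : Invertible C := C.invertibleOfIsUnitDet hdet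
  have hP : IsUnit (fromBlocks 1 0 (C⁻¹ * Eᴴ) 1 : Matrix (ι ⊕ κ) (ι ⊕ κ) ℂ) := by
    rw [isUnit_iff_isUnit_det, det_fromBlocks_zero₁₂]
    simp
  have hPH : (fromBlocks 1 0 (C⁻¹ * Eᴴ) 1 : Matrix (ι ⊕ κ) (ι ⊕ κ) ℂ)ᴴ =
      fromBlocks 1 (E * C⁻¹) 0 1 := by
    simp [fromBlocks_conjTranspose, conjTranspose_nonsing_inv, hC.eq]
  have hblock := fromBlocks_eq_of_invertible₂₂ A E Eᴴ C
  rw [invOf_eq_nonsing_inv, ← hPH] at hblock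
  have hdiag : (fromBlocks (A - E * C⁻¹ * Eᴴ) 0 0 C).IsHermitian := by
    rw [isHermitian_fromBlocks_iff]
    exact ⟨hS, by simp, by simp, hC⟩
  rw [← hermSignature_fromBlocks_zero hS hC hdiag]
  refine hermSignature_eq_of_equivalent _ _ ?_
  rw [hblock]
  exact reForm_conjTranspose_mul_mul_equivalent _ hP

theorem hermSignature_add_smul_vecMulVec (hA : A.IsHermitian) (hB : B.IsHermitian)
    (hdA : A.det ≠ 0) (hdB : B.det ≠ 0) {s : ℝ} (hs : 0 ≤ s) {a : ι → ℂ}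
    (h : B = A + (s : ℂ) • vecMulVec a (star a)) :
    hermSignature hB = hermSignature hA + 1 -
      (SignType.sign A.det.re : ℤ) * (SignType.sign B.det.re : ℤ) := by
  have hform : ∀ x, reForm B x = reForm A x + s * ‖star a ⬝ᵥ x‖ ^ 2 := fun x => by
    rw [h, reForm_add_smul_vecMulVec]
  have hle : sigPos (reForm A) ≤ sigPos (reForm B) + Module.finrank ℝ PUnit :=
    sigPos_le_sigPos_add_finrank 0 fun x _ =>
      (le_add_of_nonneg_right (by positivity)).trans_eq (hform x).symm
  have hle' : sigPos (reForm B) ≤ sigPos (reForm A) + Module.finrank ℝ ℂ :=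
    sigPos_le_sigPos_add_finrank (dotProductBilin ℝ ℝ (star a)) fun x hx => by
      rw [hform, show star a ⬝ᵥ x = 0 from hx]
      simp
  rw [sigPos_reForm hA, sigPos_reForm hB, Module.finrank_zero_of_subsingleton] at hle
  rw [sigPos_reForm hA, sigPos_reForm hB, Complex.finrank_real_complex] at hle'
  have hcA := posIndex_add_negIndex hA hdA
  have hcB := posIndex_add_negIndex hB hdB
  rw [sign_det_re hA hdA, sign_det_re hB hdB, hermSignature_eq_posIndex_sub_negIndex,
    hermSignature_eq_posIndex_sub_negIndex, ← pow_add]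
  obtain h0 | h1 : negIndex hA = negIndex hB ∨ negIndex hA = negIndex hB + 1 := by omega
  · rw [h0, Even.neg_one_pow ⟨_, rfl⟩]
    omega
  · rw [h1, Odd.neg_one_pow ⟨negIndex hB, by ring⟩]
    omega

theorem eventually_hermSignature_eq {X : Type*} [TopologicalSpace X] {M : X → Matrix ι ι ℂ}
    (hM : ∀ t, (M t).IsHermitian) {a : X} (hc : ContinuousAt M a) (hd : (M a).det ≠ 0) :
    ∀ᶠ t in 𝓝 a, hermSignature (hM t) = hermSignature (hM a) := by
  have hneg := eventually_sigPos_reForm_le hc.neg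
  simp only [Pi.neg_apply, reForm_neg, sigPos_neg] at hneg
  filter_upwards [eventually_sigPos_reForm_le hc, hneg] with t hp hn
  rw [sigPos_reForm (hM a), sigPos_reForm (hM t)] at hp
  rw [sigNeg_reForm (hM a), sigNeg_reForm (hM t)] at hn
  have ha := posIndex_add_negIndex (hM a) hd
  have ht := posIndex_add_negIndex_le (hM t)
  rw [hermSignature_eq_posIndex_sub_negIndex, hermSignature_eq_posIndex_sub_negIndex]
  omega

end Signature

/-! ### Invariance under S-equivalence -/

section Pencil

variable {m : ℕ} (V : Matrix (Fin m) (Fin m) ℤ) (a b : ℂ)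

/-- The complex matrix `a V + b Vᵀ`.  Both `t V - Vᵀ` and `B(t) = (1 - t) V + (1 - t̄) Vᵀ` are of
this form. -/
def seifertPencil : Matrix (Fin m) (Fin m) ℂ :=
  a • V.map (Int.cast : ℤ → ℂ) + b • (V.map (Int.cast : ℤ → ℂ))ᵀ

theorem aeval_alexanderPoly (t : ℂ) :
    Polynomial.aeval t (alexanderPoly V) = (seifertPencil V t (-1)).det := by
  rw [alexanderPoly, AlgHom.map_det]
  congr 1
  ext i j
  simp [seifertPencil, sub_eq_add_neg]

theorem alexander_eq (t : ℂ) :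
    alexander V t = t ^ (-((m / 2 : ℕ) : ℤ)) * (seifertPencil V t (-1)).det := by
  rw [alexander, aeval_alexanderPoly]

theorem hermitianForm_eq (t : ℂ) :
    hermitianForm V t = seifertPencil V (1 - t) (1 - star t) := rfl

theorem signatureAt_eq (t : ℂ) :
    signatureAt V t = hermSignature (hermitianForm_isHermitian V t) := rfl

theorem seifertPencil_transpose : seifertPencil Vᵀ a b = (seifertPencil V a b)ᵀ := by
  simp [seifertPencil, transpose_map]

theorem alexander_transpose (t : ℂ) : alexander Vᵀ t = alexander V t := by
  rw [alexander_eq, alexander_eq, seifertPencil_transpose, det_transpose]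

theorem signatureAt_transpose (t : ℂ) : signatureAt Vᵀ t = signatureAt V t :=
  hermSignature_eq_of_charpoly_eq _ _ <| by
    rw [hermitianForm_eq, hermitianForm_eq, seifertPencil_transpose, charpoly_transpose]

theorem seifertPencil_congruent (P : Matrix (Fin m) (Fin m) ℤ) :
    seifertPencil (Pᵀ * V * P) a b =
      (P.map (Int.cast : ℤ → ℂ))ᵀ * seifertPencil V a b * P.map (Int.cast : ℤ → ℂ) := by
  have h : (Pᵀ * V * P).map (Int.cast : ℤ → ℂ) =
      (P.map (Int.cast : ℤ → ℂ))ᵀ * V.map (Int.cast : ℤ → ℂ) * P.map (Int.cast : ℤ → ℂ) := by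
    simp only [← Int.coe_castRingHom, Matrix.map_mul, transpose_map]
  rw [seifertPencil, seifertPencil, h]
  simp only [Matrix.mul_add, Matrix.add_mul, transpose_mul, transpose_transpose,
    Matrix.mul_smul, Matrix.smul_mul, Matrix.mul_assoc]

theorem alexander_congruent {P : Matrix (Fin m) (Fin m) ℤ} (hP : IsUnit P.det) (t : ℂ) :
    alexander (Pᵀ * V * P) t = alexander V t := by
  have hdet : (P.det : ℂ) * P.det = 1 := by exact_mod_cast Int.isUnit_mul_self hP
  rw [alexander_eq, alexander_eq, seifertPencil_congruent, det_mul, det_mul, det_transpose,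
    ← Int.cast_det, mul_right_comm, hdet, one_mul]

theorem signatureAt_congruent {P : Matrix (Fin m) (Fin m) ℤ} (hP : IsUnit P.det) (t : ℂ) :
    signatureAt (Pᵀ * V * P) t = signatureAt V t := by
  have hunit : IsUnit (P.map (Int.cast : ℤ → ℂ)) := by
    rw [isUnit_iff_isUnit_det, ← Int.cast_det]
    exact hP.map (Int.castRingHom ℂ)
  have hstar : (P.map (Int.cast : ℤ → ℂ))ᴴ = (P.map (Int.cast : ℤ → ℂ))ᵀ := by
    ext i j
    simp
  refine hermSignature_eq_of_equivalent _ _ ?_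
  rw [hermitianForm_eq, hermitianForm_eq, seifertPencil_congruent, ← hstar]
  exact reForm_conjTranspose_mul_mul_equivalent _ hunit

theorem enlargeRow_eq_transpose (v : Fin m → ℤ) : enlargeRow V v = (enlargeCol Vᵀ v)ᵀ := by
  rw [enlargeRow, enlargeCol, reindex_apply, reindex_apply, transpose_submatrix,
    fromBlocks_transpose]
  congr 2
  ext i j
  fin_cases i <;> fin_cases j <;> rfl

theorem seifertPencil_enlargeCol (v : Fin m → ℤ) :
    seifertPencil (enlargeCol V v) a b = reindex finSumFinEquiv finSumFinEquiv
      (fromBlocks (seifertPencil V a b) (of fun i j => if j = 0 then a * v i else 0)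
        (of fun i j => if i = 0 then b * v j else 0) !![0, a; b, 0]) := by
  ext i j
  obtain ⟨i, rfl⟩ := finSumFinEquiv.surjective i
  obtain ⟨j, rfl⟩ := finSumFinEquiv.surjective j
  rcases i with i | i <;> rcases j with j | j
  · simp [enlargeCol, seifertPencil]
  · fin_cases j <;> simp [enlargeCol, seifertPencil]
  · fin_cases i <;> simp [enlargeCol, seifertPencil]
  · fin_cases i <;> fin_cases j <;> simp [enlargeCol, seifertPencil]

variable {a b}

theorem inv_antidiagonal_fin_two {K : Type*} [Field K] {a b : K} (ha : a ≠ 0) (hb : b ≠ 0) :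
    (!![0, a; b, 0] : Matrix (Fin 2) (Fin 2) K)⁻¹ = !![0, b⁻¹; a⁻¹, 0] :=
  inv_eq_right_inv <| by
    ext i j
    fin_cases i <;> fin_cases j <;> simp [ha, hb]

theorem schur_correction_eq_zero {K ι κ : Type*} [Field K] {a b : K} (ha : a ≠ 0) (hb : b ≠ 0)
    (x : ι → K) (y : κ → K) :
    (of fun i (j : Fin 2) => if j = 0 then x i else 0) *
        (!![0, a; b, 0] : Matrix (Fin 2) (Fin 2) K)⁻¹ *
      (of fun (i : Fin 2) j => if i = 0 then y j else 0) = 0 := by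
  rw [inv_antidiagonal_fin_two ha hb]
  ext i j
  simp [Matrix.mul_apply]

theorem det_seifertPencil_enlargeCol (ha : a ≠ 0) (hb : b ≠ 0) (v : Fin m → ℤ) :
    (seifertPencil (enlargeCol V v) a b).det = -(a * b) * (seifertPencil V a b).det := by
  have hdet : (!![0, a; b, 0] : Matrix (Fin 2) (Fin 2) ℂ).det = -(a * b) := by simp
  have : Invertible (!![0, a; b, 0] : Matrix (Fin 2) (Fin 2) ℂ) :=
    invertibleOfIsUnitDet _ (by simp [ha, hb])
  rw [seifertPencil_enlargeCol, det_reindex_self, det_fromBlocks₂₂, invOf_eq_nonsing_inv,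
    schur_correction_eq_zero ha hb, sub_zero, hdet]

theorem alexander_enlargeCol (v : Fin m → ℤ) {t : ℂ} (ht : t ≠ 0) :
    alexander (enlargeCol V v) t = alexander V t := by
  have hexp : -(((m + 2) / 2 : ℕ) : ℤ) + 1 = -((m / 2 : ℕ) : ℤ) := by omega
  rw [alexander_eq, alexander_eq, det_seifertPencil_enlargeCol V ht (neg_ne_zero.2 one_ne_zero),
    mul_neg_one, neg_neg, ← mul_assoc, ← zpow_add_one₀ ht, hexp]

theorem hermSignature_eq_zero_of_trace_eq_zero {A : Matrix (Fin 2) (Fin 2) ℂ} (hA : A.IsHermitian)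
    (h : A.trace = 0) : hermSignature hA = 0 := by
  have hsum : hA.eigenvalues 0 + hA.eigenvalues 1 = 0 := by
    rw [hA.trace_eq_sum_eigenvalues, Fin.sum_univ_two] at h
    exact Complex.ofReal_injective (by simpa using h)
  rw [hermSignature, Fin.sum_univ_two, eq_neg_of_add_eq_zero_left hsum, Left.sign_neg]
  simp

theorem signatureAt_enlargeCol (v : Fin m → ℤ) {t : ℂ} (ht : t ≠ 1) :
    signatureAt (enlargeCol V v) t = signatureAt V t := by
  set z := 1 - t
  have hz : z ≠ 0 := sub_ne_zero.2 ht.symm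
  set E : Matrix (Fin m) (Fin 2) ℂ := of fun i j => if j = 0 then z * v i else 0
  set C : Matrix (Fin 2) (Fin 2) ℂ := !![0, z; star z, 0]
  have hE : Eᴴ = of fun i j => if i = 0 then star z * v j else 0 := by
    ext i j
    fin_cases i <;> simp [E]
  have hC : C.IsHermitian := by
    ext i j
    fin_cases i <;> fin_cases j <;> simp [C]
  have hCdet : IsUnit C.det := by simp [C, hz]
  have hcorr : hermitianForm V t - E * C⁻¹ * Eᴴ = hermitianForm V t := by
    rw [hE, schur_correction_eq_zero hz (star_ne_zero.2 hz), sub_zero]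
  have hblock : hermitianForm (enlargeCol V v) t =
      reindex finSumFinEquiv finSumFinEquiv (fromBlocks (hermitianForm V t) E Eᴴ C) := by
    have hstar : 1 - star t = star z := by simp [z]
    rw [hE, hermitianForm_eq, hermitianForm_eq, seifertPencil_enlargeCol, hstar]
  have hB : (fromBlocks (hermitianForm V t) E Eᴴ C).IsHermitian :=
    isHermitian_fromBlocks_iff.2
      ⟨hermitianForm_isHermitian V t, rfl, conjTranspose_conjTranspose E, hC⟩
  have hS : (hermitianForm V t - E * C⁻¹ * Eᴴ).IsHermitian := by
    rw [hcorr]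
    exact hermitianForm_isHermitian V t
  calc signatureAt (enlargeCol V v) t = hermSignature hB :=
        hermSignature_eq_of_charpoly_eq _ _ (by rw [hblock, charpoly_reindex])
    _ = hermSignature hS + hermSignature hC := hermSignature_fromBlocks hC hCdet E hB hS
    _ = signatureAt V t + 0 :=
        congrArg₂ _ (hermSignature_eq_of_charpoly_eq _ _ (by rw [hcorr]))
          (hermSignature_eq_zero_of_trace_eq_zero hC (by simp [C, trace_fin_two]))
    _ = signatureAt V t := add_zero _

end Pencil

theorem SEquivalent.even_iff {m k : ℕ} {V : Matrix (Fin m) (Fin m) ℤ}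
    {W : Matrix (Fin k) (Fin k) ℤ} (h : SEquivalent V W) : Even m ↔ Even k := by
  induction h with
  | congruent => rfl
  | col | row => simp [Nat.even_add]
  | symm _ ih => exact ih.symm
  | trans _ _ ih₁ ih₂ => exact ih₁.trans ih₂

theorem SEquivalent.alexander_eq {m k : ℕ} {V : Matrix (Fin m) (Fin m) ℤ}
    {W : Matrix (Fin k) (Fin k) ℤ} (h : SEquivalent V W) {t : ℂ} (ht : t ≠ 0) :
    alexander V t = alexander W t := by
  induction h with
  | congruent V P hP => exact (alexander_congruent V hP t).symm
  | col V v => exact (alexander_enlargeCol V v ht).symm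
  | row V v =>
    rw [enlargeRow_eq_transpose, alexander_transpose, alexander_enlargeCol _ v ht,
      alexander_transpose]
  | symm _ ih => exact ih.symm
  | trans _ _ ih₁ ih₂ => exact ih₁.trans ih₂

theorem SEquivalent.signatureAt_eq {m k : ℕ} {V : Matrix (Fin m) (Fin m) ℤ}
    {W : Matrix (Fin k) (Fin k) ℤ} (h : SEquivalent V W) {t : ℂ} (ht : t ≠ 1) :
    signatureAt V t = signatureAt W t := by
  induction h with
  | congruent V P hP => exact (signatureAt_congruent V hP t).symm
  | col V v => exact (signatureAt_enlargeCol V v ht).symm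
  | row V v =>
    rw [enlargeRow_eq_transpose, signatureAt_transpose, signatureAt_enlargeCol _ v ht,
      signatureAt_transpose]
  | symm _ ih => exact ih.symm
  | trans _ _ ih₁ ih₂ => exact ih₁.trans ih₂

/-! ### Orbits of permutations -/

section Cycles

theorem finrank_range_add_finrank_ker {R M N : Type*} [CommRing R] [IsDomain R] [AddCommGroup M]
    [AddCommGroup N] [Module R M] [Module R N] [Module.Finite R M] (f : M →ₗ[R] N) :
    Module.finrank R (LinearMap.range f) + Module.finrank R (LinearMap.ker f) =
      Module.finrank R M := by
  rw [← f.quotKerEquivRange.finrank_eq, Submodule.finrank_quotient_add_finrank]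

open Equiv Perm

variable {α : Type*} (f : Perm α)

theorem eq_of_sameCycle {f : Perm α} {β : Type*} {F : α → β} (hF : ∀ a, F (f a) = F a) {a b : α}
    (h : f.SameCycle a b) : F a = F b := by
  obtain ⟨i, rfl⟩ := h
  have hF' (a : α) : F (f⁻¹ a) = F a :=
    (hF _).symm.trans (congrArg F (f.apply_symm_apply a))
  induction i using Int.induction_on generalizing a with
  | zero => rfl
  | succ i ih => rw [_root_.zpow_add_one, Perm.mul_apply, ← ih, hF]
  | pred i ih => rw [_root_.zpow_sub_one, Perm.mul_apply, ← ih, hF']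

/-- The number of cycles of a permutation, fixed points included; zero if there are infinitely many
cycles. -/
def numCycles : ℕ := Nat.card (Quotient (SameCycle.setoid f))

/-- The integral functions that are constant on the cycles of a permutation. -/
def invariantFunctions : Submodule ℤ (α → ℤ) where
  carrier := {h | ∀ a, h (f a) = h a}
  zero_mem' _ := rfl
  add_mem' hx hy a := by simp only [Pi.add_apply, hx a, hy a]
  smul_mem' r x hx a := by simp only [Pi.smul_apply, hx a]

theorem numCycles_eq_one [Nonempty α] {f : Perm α} (hf : ∀ a b, f.SameCycle a b) :
    numCycles f = 1 :=
  Nat.card_eq_one_iff_unique.2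
    ⟨⟨fun q r => Quotient.inductionOn₂ q r fun a b => Quotient.sound (hf a b)⟩,
      .map (Quotient.mk _) inferInstance⟩

theorem range_funLeft_quotient_mk :
    LinearMap.range (LinearMap.funLeft ℤ ℤ (Quotient.mk (SameCycle.setoid f))) =
      invariantFunctions f := by
  ext h
  constructor
  · rintro ⟨F, rfl⟩ a
    exact congrArg F (Quotient.sound (sameCycle_apply_left.2 SameCycle.rfl))
  · intro hh
    exact ⟨Quotient.lift h fun _ _ => eq_of_sameCycle hh, rfl⟩

theorem finrank_invariantFunctions [Finite α] :
    Module.finrank ℤ (invariantFunctions f) = numCycles f := by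
  have := Fintype.ofFinite (Quotient (SameCycle.setoid f))
  rw [← range_funLeft_quotient_mk, LinearMap.finrank_range_of_inj
    (LinearMap.funLeft_injective_of_surjective ℤ ℤ _ Quotient.mk_surjective),
    Module.finrank_fintype_fun_eq_card, numCycles, Nat.card_eq_fintype_card]

variable [Fintype α] [DecidableEq α]

theorem exists_surjective_cycleFactorsFinset_sum :
    ∃ p : α → f.cycleFactorsFinset ⊕ {a // a ∉ f.support},
      p.Surjective ∧ ∀ a b, p a = p b ↔ f.SameCycle a b := by
  let p (a : α) : f.cycleFactorsFinset ⊕ {a // a ∉ f.support} :=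
    if h : a ∈ f.support then .inl ⟨f.cycleOf a, cycleOf_mem_cycleFactorsFinset_iff.2 h⟩
    else .inr ⟨a, h⟩
  have p_inl (a) (h : a ∈ f.support) :
      p a = .inl ⟨f.cycleOf a, cycleOf_mem_cycleFactorsFinset_iff.2 h⟩ := dif_pos h
  have p_inr (a) (h : a ∉ f.support) : p a = .inr ⟨a, h⟩ := dif_neg h
  have p_apply (a) : p (f a) = p a := by
    by_cases h : a ∈ f.support
    · rw [p_inl a h, p_inl (f a) (apply_mem_support.2 h)]
      congr 2
      exact SameCycle.cycleOf_eq (sameCycle_apply_left.2 SameCycle.rfl)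
    · rw [notMem_support.1 h]
  refine ⟨p, ?_, fun a b => ⟨fun hab => ?_, eq_of_sameCycle p_apply⟩⟩
  · rintro (⟨c, hc⟩ | ⟨a, ha⟩)
    · obtain ⟨a, ha⟩ := (mem_cycleFactorsFinset_iff.1 hc).1.nonempty_support
      refine ⟨a, ?_⟩
      rw [p_inl a (mem_cycleFactorsFinset_support_le hc ha), Sum.inl.injEq, Subtype.mk.injEq]
      exact (cycle_is_cycleOf ha hc).symm
    · exact ⟨a, p_inr a ha⟩
  · by_cases ha : a ∈ f.support <;> by_cases hb : b ∈ f.support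
    · rw [p_inl a ha, p_inl b hb, Sum.inl.injEq, Subtype.mk.injEq] at hab
      exact (sameCycle_iff_cycleOf_eq_of_mem_support ha hb).2 hab
    · simp [p_inl a ha, p_inr b hb] at hab
    · simp [p_inr a ha, p_inl b hb] at hab
    · rw [p_inr a ha, p_inr b hb, Sum.inr.injEq, Subtype.mk.injEq] at hab
      rw [hab]

theorem numCycles_add_card_support :
    numCycles f + #f.support = #f.cycleFactorsFinset + Fintype.card α := by
  obtain ⟨p, hp, hpp⟩ := exists_surjective_cycleFactorsFinset_sum f
  have hker : SameCycle.setoid f = Setoid.ker p := Setoid.ext fun a b => (hpp a b).symm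
  rw [numCycles, hker, Nat.card_congr (Setoid.quotientKerEquivOfSurjective p hp),
    Nat.card_eq_fintype_card, Fintype.card_sum, Fintype.card_coe, Fintype.card_subtype_compl,
    Fintype.card_coe, add_assoc, Nat.sub_add_cancel (Finset.card_le_univ _)]

theorem sign_eq_neg_one_pow_card_add_numCycles :
    sign f = (-1) ^ (Fintype.card α + numCycles f) := by
  have hcycles : Multiset.card f.cycleType = #f.cycleFactorsFinset := by
    rw [cycleType_def, Multiset.card_map, Finset.card_val]
  have hcard := numCycles_add_card_support f
  rw [sign_of_cycleType, sum_cycleType, hcycles, neg_one_pow_congr]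
  grind

end Cycles

/-! ### The homology of the Seifert surface of a diagram -/

namespace KnotDiagram

variable (D : KnotDiagram)

theorem n_pos : 0 < D.n := by
  refine Nat.pos_of_ne_zero fun h => ?_
  have : IsEmpty (Fin D.n) := h ▸ Fin.isEmpty
  have : IsEmpty D.Region := ⟨Quot.rec (fun p => isEmptyElim p.1.1) fun p => isEmptyElim p.1.1⟩
  have hplanar := D.planar
  rw [Nat.card_of_isEmpty] at hplanar
  omega

instance : Nonempty D.Edge := ⟨(⟨0, D.n_pos⟩, true)⟩

theorem eq_of_next_eq {β : Type*} {F : D.Edge → β} (hF : ∀ e, F (D.next e) = F e) (e e' : D.Edge) :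
    F e = F e' :=
  eq_of_sameCycle hF (D.single e e')

theorem edge_cases (e : D.Edge) : ∃ c, e = D.inL c ∨ e = D.inR c := by
  obtain ⟨⟨c, b⟩, rfl⟩ := D.next.symm.surjective e
  cases b
  · exact ⟨c, Or.inr rfl⟩
  · exact ⟨c, Or.inl rfl⟩

theorem sum_out {A : Type*} [AddCommMonoid A] (g : D.Edge → A) :
    ∑ c, (g (D.outL c) + g (D.outR c)) = ∑ e, g e :=
  ((Fintype.sum_prod_type g).trans
    (Fintype.sum_congr _ _ fun _ => (Fintype.sum_bool _).trans (add_comm _ _))).symm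

theorem sum_in {A : Type*} [AddCommMonoid A] (g : D.Edge → A) :
    ∑ c, (g (D.inL c) + g (D.inR c)) = ∑ e, g e := by
  rw [← Equiv.sum_comp D.next.symm g, ← D.sum_out]
  exact Fintype.sum_congr _ _ fun c => add_comm _ _

/-- The cellular boundary of a 1-chain of the curve. -/
def boundary : (D.Edge → ℤ) →ₗ[ℤ] (Fin D.n → ℤ) :=
  let value (e : D.Edge) : (D.Edge → ℤ) →ₗ[ℤ] ℤ := LinearMap.proj e
  LinearMap.pi fun c =>
    value (D.inL c) + value (D.inR c) - (value (D.outL c) + value (D.outR c))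

theorem boundary_apply (x : D.Edge → ℤ) (c : Fin D.n) :
    D.boundary x c = x (D.inL c) + x (D.inR c) - (x (D.outL c) + x (D.outR c)) :=
  rfl

theorem ker_boundary : LinearMap.ker D.boundary = D.cycles := by
  ext x
  rw [LinearMap.mem_ker, funext_iff]
  exact forall_congr' fun c => by rw [boundary_apply, Pi.zero_apply, sub_eq_zero, eq_comm]

/-- The sum of the coefficients of a 0-chain of the curve. -/
def augmentation : (Fin D.n → ℤ) →ₗ[ℤ] ℤ := ∑ c, LinearMap.proj c

theorem augmentation_apply (z : Fin D.n → ℤ) : D.augmentation z = ∑ c, z c := by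
  simp [augmentation]

theorem boundary_single (e : D.Edge) :
    D.boundary (Pi.single e 1) = Pi.single (D.next e).1 1 - Pi.single e.1 1 := by
  have hsum (p : D.Edge) (c : Fin D.n) : (Pi.single p 1 : D.Edge → ℤ) (c, true) +
      (Pi.single p 1 : D.Edge → ℤ) (c, false) = (Pi.single p.1 1 : Fin D.n → ℤ) c := by
    obtain ⟨d, b⟩ := p
    cases b <;> simp [Pi.single_apply, Prod.ext_iff]
  have hin (p : D.Edge) : (Pi.single e 1 : D.Edge → ℤ) (D.next.symm p) =
      (Pi.single (D.next e) 1 : D.Edge → ℤ) p := by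
    simp only [Pi.single_apply, Equiv.symm_apply_eq]
  funext c
  rw [boundary_apply, Pi.sub_apply, ← hsum, ← hsum, ← hin, ← hin,
    add_comm ((Pi.single e 1 : D.Edge → ℤ) (D.outL c))]
  rfl

theorem range_boundary : LinearMap.range D.boundary = LinearMap.ker D.augmentation := by
  apply le_antisymm
  · rintro _ ⟨x, rfl⟩
    simp only [LinearMap.mem_ker, augmentation_apply, boundary_apply, Finset.sum_sub_distrib,
      sum_in, sum_out, sub_self]
  · intro z hz
    rw [LinearMap.mem_ker, augmentation_apply] at hz
    let q := (LinearMap.range D.boundary).mkQ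
    have hq (e : D.Edge) : q (Pi.single (D.next e).1 1) = q (Pi.single e.1 1) := by
      rw [← sub_eq_zero, ← map_sub, ← boundary_single]
      exact (Submodule.Quotient.mk_eq_zero _).2 ⟨_, rfl⟩
    have hq_const (c d : Fin D.n) : q (Pi.single c 1) = q (Pi.single d 1) :=
      D.eq_of_next_eq (F := fun e => q (Pi.single e.1 1)) hq (c, true) (d, true)
    let c₀ : Fin D.n := ⟨0, D.n_pos⟩
    refine (Submodule.Quotient.mk_eq_zero _).1 ?_
    calc q z = q (∑ c, z c • Pi.single c 1) := by rw [← pi_eq_sum_univ' z]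
      _ = ∑ c, z c • q (Pi.single c₀ 1) := by simp only [map_sum, map_smul, hq_const _ c₀]
      _ = 0 := by rw [← Finset.sum_smul, hz, zero_smul]

theorem finrank_cycles : Module.finrank ℤ D.cycles = D.n + 1 := by
  have haug : LinearMap.range D.augmentation = ⊤ :=
    LinearMap.range_eq_top.2 fun a =>
      ⟨Pi.single ⟨0, D.n_pos⟩ a, by simp [augmentation_apply]⟩
  have h₁ := finrank_range_add_finrank_ker D.boundary
  have h₀ := finrank_range_add_finrank_ker D.augmentation
  rw [ker_boundary, range_boundary, Module.finrank_fintype_fun_eq_card, Fintype.card_prod,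
    Fintype.card_fin, Fintype.card_bool] at h₁
  rw [haug, finrank_top, Module.finrank_self, Module.finrank_fintype_fun_eq_card,
    Fintype.card_fin] at h₀
  omega

/-- The permutation of the edges that follows the Seifert circles. -/
def seifertPerm : Equiv.Perm D.Edge :=
  (Equiv.prodCongrRight fun _ : Fin D.n => Equiv.swap true false) * D.next

theorem seifertPerm_inL (c : Fin D.n) : D.seifertPerm (D.inL c) = D.outL c := by
  simp [seifertPerm, OrientedShadow.inL, OrientedShadow.outL]

theorem seifertPerm_inR (c : Fin D.n) : D.seifertPerm (D.inR c) = D.outR c := by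
  simp [seifertPerm, OrientedShadow.inR, OrientedShadow.outR]

theorem mem_discBoundaries {x : D.cycles} :
    x ∈ D.discBoundaries ↔
      ∀ c, x.1 (D.outL c) = x.1 (D.inL c) ∧ x.1 (D.outR c) = x.1 (D.inR c) := by
  have hker : x ∈ D.discBoundaries ↔ ∀ c, x.1 (D.outL c) - x.1 (D.inL c) = 0 :=
    LinearMap.mem_ker.trans funext_iff
  rw [hker]
  refine forall_congr' fun c => ?_
  have := x.2 c
  omega

theorem map_discBoundaries :
    D.discBoundaries.map D.cycles.subtype = invariantFunctions D.seifertPerm := by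
  ext h
  constructor
  · rintro ⟨x, hx, rfl⟩ e
    have hx' := D.mem_discBoundaries.1 hx
    obtain ⟨c, rfl | rfl⟩ := D.edge_cases e
    · rw [seifertPerm_inL]; exact (hx' c).1
    · rw [seifertPerm_inR]; exact (hx' c).2
  · intro hh
    have hL (c) : h (D.outL c) = h (D.inL c) := by rw [← seifertPerm_inL]; exact hh _
    have hR (c) : h (D.outR c) = h (D.inR c) := by rw [← seifertPerm_inR]; exact hh _
    exact ⟨⟨h, fun c => by rw [hL, hR]⟩, D.mem_discBoundaries.2 fun c => ⟨hL c, hR c⟩, rfl⟩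

theorem finrank_discBoundaries : Module.finrank ℤ D.discBoundaries = numCycles D.seifertPerm := by
  rw [← finrank_invariantFunctions, ← map_discBoundaries]
  exact (Submodule.equivMapOfInjective _ D.cycles.injective_subtype _).finrank_eq

theorem sign_seifertPerm :
    Equiv.Perm.sign D.seifertPerm = (-1) ^ D.n * Equiv.Perm.sign D.next := by
  rw [seifertPerm, Equiv.Perm.sign_mul, Equiv.Perm.sign_prodCongrRight]
  simp

theorem even_numCycles_seifertPerm_iff : Even (numCycles D.seifertPerm) ↔ Even (D.n + 1) := by
  have h := D.sign_seifertPerm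
  rw [sign_eq_neg_one_pow_card_add_numCycles, sign_eq_neg_one_pow_card_add_numCycles,
    numCycles_eq_one D.single, Fintype.card_prod, Fintype.card_bool, ← pow_add,
    ← mul_inv_eq_one, Int.units_inv_eq_self, ← pow_add,
    neg_one_pow_eq_one_iff_even (by decide)] at h
  grind

theorem even_finrank_seifertH1 : Even (Module.finrank ℤ D.SeifertH1) := by
  have h := D.discBoundaries.finrank_quotient_add_finrank
  rw [finrank_cycles, finrank_discBoundaries] at h
  have hcycles := D.even_numCycles_seifertPerm_iff
  rw [← h, Nat.even_add] at hcycles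
  tauto

/-- The region on the left (`b = true`) or right (`b = false`) of an edge. -/
def region (e : D.Edge) (b : Bool) : D.Region := Quot.mk _ (e, b)

theorem region_west (c : Fin D.n) : D.region (D.inL c) true = D.region (D.outL c) true :=
  Quot.sound (.west c)

theorem region_north (c : Fin D.n) : D.region (D.outL c) false = D.region (D.outR c) true :=
  Quot.sound (.north c)

theorem region_east (c : Fin D.n) : D.region (D.outR c) false = D.region (D.inR c) false :=
  Quot.sound (.east c)

theorem region_south (c : Fin D.n) : D.region (D.inR c) true = D.region (D.inL c) false :=
  Quot.sound (.south c)

/-- The cellular boundary of a 2-chain of the sphere, whose 2-cells are the regions of the curve. -/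
def regionBoundary : (D.Region → ℤ) →ₗ[ℤ] D.cycles :=
  (LinearMap.funLeft ℤ ℤ (D.region · true) - LinearMap.funLeft ℤ ℤ (D.region · false)).codRestrict
    D.cycles fun r c => by
      simp only [LinearMap.sub_apply, Pi.sub_apply, LinearMap.funLeft_apply, region_west,
        region_north, region_east, region_south]
      ring

theorem apply_region_eq_of_mem_ker_regionBoundary {r : D.Region → ℤ}
    (hr : r ∈ LinearMap.ker D.regionBoundary) (q q' : D.Region) : r q = r q' := by
  have hsides (e : D.Edge) : r (D.region e true) = r (D.region e false) :=
    sub_eq_zero.1 (congrFun (congrArg Subtype.val hr) e)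
  have hnext (e : D.Edge) : r (D.region (D.next e) true) = r (D.region e true) := by
    obtain ⟨c, rfl | rfl⟩ := D.edge_cases e
    · have : D.next (D.inL c) = D.outR c := D.next.apply_symm_apply _
      rw [this, ← region_north, ← hsides, ← region_west]
    · have : D.next (D.inR c) = D.outL c := D.next.apply_symm_apply _
      rw [this, ← region_west, hsides, ← region_south]
  have hleft := D.eq_of_next_eq (F := fun e => r (D.region e true)) hnext
  have hany (e : D.Edge) (b : Bool) : r (D.region e b) = r (D.region e true) := by
    cases b
    · exact (hsides e).symm
    · rfl
  obtain ⟨⟨e, b⟩, rfl⟩ := Quot.mk_surjective q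
  obtain ⟨⟨e', b'⟩, rfl⟩ := Quot.mk_surjective q'
  exact (hany e b).trans ((hleft e e').trans (hany e' b').symm)

theorem finrank_ker_regionBoundary_le : Module.finrank ℤ (LinearMap.ker D.regionBoundary) ≤ 1 := by
  have hone : (1 : D.Region → ℤ) ∈ LinearMap.ker D.regionBoundary :=
    Subtype.ext (funext fun _ => sub_self (1 : ℤ))
  obtain ⟨e⟩ : Nonempty D.Edge := inferInstance
  refine finrank_le_one ⟨1, hone⟩ fun r => ⟨r.1 (D.region e true), Subtype.ext (funext fun q => ?_)⟩
  exact (mul_one _).trans (D.apply_region_eq_of_mem_ker_regionBoundary r.2 _ q)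

theorem finrank_quotient_range_regionBoundary :
    Module.finrank ℤ (D.cycles ⧸ LinearMap.range D.regionBoundary) = 0 := by
  have : Finite D.Region := Nat.finite_of_card_ne_zero (by rw [D.planar]; omega)
  have := Fintype.ofFinite D.Region
  have hregions := finrank_range_add_finrank_ker D.regionBoundary
  rw [Module.finrank_fintype_fun_eq_card, ← Nat.card_eq_fintype_card, D.planar] at hregions
  have hcycles := (LinearMap.range D.regionBoundary).finrank_quotient_add_finrank
  rw [finrank_cycles] at hcycles
  have hker := D.finrank_ker_regionBoundary_le
  omega

theorem exists_smul_eq_regionBoundary (y : D.cycles) :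
    ∃ (N : ℤ) (r : D.Region → ℤ), N ≠ 0 ∧ N • y = D.regionBoundary r := by
  obtain ⟨N, hN, h⟩ := Module.finrank_eq_zero_iff.1 D.finrank_quotient_range_regionBoundary
    ((LinearMap.range D.regionBoundary).mkQ y)
  rw [← map_smul, Submodule.mkQ_apply, Submodule.Quotient.mk_eq_zero] at h
  obtain ⟨r, hr⟩ := h
  exact ⟨N, r, hN, hr.symm⟩

/-- The amount of a cycle that runs along the arc passing over its own push-off at each crossing. -/
def overFlow : D.cycles →ₗ[ℤ] (Fin D.n → ℤ) :=
  LinearMap.funLeft ℤ ℤ (fun c => if D.sign c = 1 then D.outR c else D.inR c) ∘ₗ D.cycles.subtype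

/-- The linking number as a bilinear form. -/
def linkingForm : D.cycles →ₗ[ℤ] D.cycles →ₗ[ℤ] ℤ :=
  (dotProductBilin ℤ ℤ).compl₁₂ D.overFlow D.bandFlow

theorem linkingForm_apply (x y : D.cycles) : D.linkingForm x y = D.linking x y :=
  Fintype.sum_congr _ _ fun c => congrArg (· * D.bandFlow y c)
    (apply_ite x.1 (D.sign c = 1) (D.outR c) (D.inR c))

theorem linking_discBoundaries_right {y : D.cycles} (hy : y ∈ D.discBoundaries) (x : D.cycles) :
    D.linking x y = 0 := by
  simp [linking, LinearMap.mem_ker.1 hy]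

theorem linking_discBoundaries_left {x : D.cycles} (hx : x ∈ D.discBoundaries) (y : D.cycles) :
    D.linking x y = 0 := by
  -- On the sphere a nonzero multiple of `y` bounds regions, which reduces the claim to `y = ∂r`;
  -- there the sum telescopes along the Seifert circles that make up `x`.
  obtain ⟨N, r, hN, hr⟩ := D.exists_smul_eq_regionBoundary y
  suffices h : D.linking x (D.regionBoundary r) = 0 by
    rw [← hr, ← linkingForm_apply, map_smul, linkingForm_apply, smul_eq_mul] at h
    exact (mul_eq_zero.1 h).resolve_left hN
  have hx' := D.mem_discBoundaries.1 hx
  have hsum := (D.sum_in fun e => x.1 e * r (D.region e true)).trans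
    (D.sum_out fun e => x.1 e * r (D.region e true)).symm
  rw [← sub_eq_zero, ← Finset.sum_sub_distrib] at hsum
  rw [← hsum, linking]
  refine Finset.sum_congr rfl fun c _ => ?_
  have hband : D.bandFlow (D.regionBoundary r) c =
      (r (D.region (D.outL c) true) - r (D.region (D.outL c) false)) -
        (r (D.region (D.inL c) true) - r (D.region (D.inL c) false)) := rfl
  rw [hband, region_west, region_north, ← region_south, (hx' c).1, (hx' c).2, ite_self]
  ring

theorem linking_congr {x x' y y' : D.cycles} (hx : x - x' ∈ D.discBoundaries)
    (hy : y - y' ∈ D.discBoundaries) : D.linking x y = D.linking x' y' := by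
  have hleft := D.linking_discBoundaries_left hx y
  have hright := D.linking_discBoundaries_right hy x'
  rw [← linkingForm_apply, map_sub, LinearMap.sub_apply] at hleft
  rw [← linkingForm_apply, map_sub] at hright
  rw [← linkingForm_apply, ← linkingForm_apply, sub_eq_zero.1 hleft, sub_eq_zero.1 hright]

theorem linking_sum_smul_sum_smul {m k : ℕ} (P : Matrix (Fin m) (Fin k) ℤ) (x : Fin m → D.cycles)
    (i j : Fin k) : D.linking (∑ p, P p i • x p) (∑ q, P q j • x q) =
      (Pᵀ * (of fun p q => D.linking (x p) (x q)) * P) i j := by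
  simp only [← linkingForm_apply, map_sum, map_smul, LinearMap.sum_apply, LinearMap.smul_apply,
    smul_eq_mul, mul_apply, transpose_apply, of_apply, Finset.sum_mul, Finset.mul_sum]
  refine Finset.sum_congr rfl fun q _ => Finset.sum_congr rfl fun p _ => by ring

theorem IsDiagramSeifertMatrix.sEquivalent {D : KnotDiagram} {m k : ℕ}
    {V : Matrix (Fin m) (Fin m) ℤ} {W : Matrix (Fin k) (Fin k) ℤ} (hV : D.IsDiagramSeifertMatrix V)
    (hW : D.IsDiagramSeifertMatrix W) : SEquivalent V W := by
  obtain ⟨b, x, hx, hV⟩ := hV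
  obtain ⟨b', x', hx', hW⟩ := hW
  obtain rfl : m = k := by
    simpa using (Module.finrank_eq_card_basis b).symm.trans (Module.finrank_eq_card_basis b')
  let P := b.toMatrix b'
  have := b.invertibleToMatrix b'
  have hP : IsUnit P.det := (isUnit_iff_isUnit_det P).1 (isUnit_of_invertible P)
  have hx_change (j : Fin m) : x' j - ∑ i, P i j • x i ∈ D.discBoundaries := by
    rw [← Submodule.Quotient.mk_eq_zero, ← Submodule.mkQ_apply, map_sub, map_sum, hx', sub_eq_zero,
      ← b.sum_toMatrix_smul_self b' j]
    exact Finset.sum_congr rfl fun i _ => by rw [map_smul, hx]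
  have hV_eq : (of fun p q => D.linking (x p) (x q)) = V := ext fun p q => (hV p q).symm
  have hW_eq : W = Pᵀ * V * P := by
    ext i j
    rw [hW, D.linking_congr (hx_change i) (hx_change j), linking_sum_smul_sum_smul, hV_eq]
  exact hW_eq ▸ .congruent V P hP

theorem IsDiagramSeifertMatrix.even {D : KnotDiagram} {m : ℕ} {V : Matrix (Fin m) (Fin m) ℤ}
    (hV : D.IsDiagramSeifertMatrix V) : Even m := by
  obtain ⟨b, -⟩ := hV
  simpa [Module.finrank_eq_card_basis b] using D.even_finrank_seifertH1

theorem resolve_sign (c : Fin D.n) : D.resolve c (D.sign c) = D := by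
  simp [resolve]

theorem linking_resolve_neg (c : Fin D.n) (x y : D.cycles) :
    (D.resolve c (-D.sign c)).linking x y =
      D.linking x y + D.sign c * (D.bandFlow x c * D.bandFlow y c) := by
  change ∑ d, (if Function.update D.sign c (-D.sign c) d = 1 then x.1 (D.outR d)
    else x.1 (D.inR d)) * D.bandFlow y d = _
  rw [linking, ← sub_eq_iff_eq_add', ← Finset.sum_sub_distrib, Finset.sum_eq_single_of_mem c
    (Finset.mem_univ c) fun d _ hd => by rw [Function.update_of_ne hd, sub_self]]
  have hcycle := x.2 c
  have hband : D.bandFlow x c = x.1 (D.outL c) - x.1 (D.inL c) := rfl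
  have hne : (-1 : ℤˣ) ≠ 1 := by decide
  rw [Function.update_self, hband]
  rcases Int.units_eq_one_or (D.sign c) with hs | hs
  · simp only [hs, hne, if_true, if_false, Units.val_one]
    linear_combination -D.bandFlow y c * hcycle
  · simp only [hs, hne, if_true, if_false, neg_neg, Units.val_neg, Units.val_one]
    linear_combination D.bandFlow y c * hcycle

theorem IsDiagramSeifertMatrix.exists_resolve_neg {D : KnotDiagram} {m : ℕ}
    {V : Matrix (Fin m) (Fin m) ℤ} (hV : D.IsDiagramSeifertMatrix V) (c : Fin D.n) :
    ∃ f : Fin m → ℤ, (D.resolve c (-D.sign c)).IsDiagramSeifertMatrix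
      (V + (D.sign c : ℤ) • vecMulVec f f) := by
  obtain ⟨b, x, hx, hV⟩ := hV
  refine ⟨fun i => D.bandFlow (x i) c, b, x, hx, fun i j => ?_⟩
  rw [linking_resolve_neg, ← hV]
  rfl

end KnotDiagram

/-! ### Signs and orders of analytic functions -/

section SgnAt

variable {f : ℝ → ℝ} {a : ℝ} {n : ℕ}

theorem sgnAt_eq_sign_iteratedDeriv (hf : AnalyticAt ℝ f a) (hn : analyticOrderAt f a = n) :
    sgnAt f a = SignType.sign (iteratedDeriv n f a) := by
  classical
  obtain ⟨hlt, hne⟩ := (analyticOrderAt_eq_nat_iff_iteratedDeriv_eq_zero hf).1 hn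
  have hex : ∃ k, iteratedDeriv k f a ≠ 0 := ⟨n, hne⟩
  have hfind : Nat.find hex = n := (Nat.find_eq_iff hex).2 ⟨hne, fun k hk => not_not.2 (hlt k hk)⟩
  rw [sgnAt, dif_pos hex, hfind]

theorem iteratedDeriv_eq_factorial_mul {g : ℝ → ℝ} (hg : AnalyticAt ℝ g a)
    (hfg : ∀ᶠ x in 𝓝 a, f x = (x - a) ^ n • g x) : iteratedDeriv n f a = n.factorial * g a := by
  have hpow : ∀ k, iteratedDeriv k (fun x => (x - a) ^ n) a = if k = n then n.factorial else 0 := by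
    intro k
    simp only [iteratedDeriv_comp_sub_const k (· ^ n) a, sub_self, iteratedDeriv_fun_pow_zero]
  simp only [smul_eq_mul] at hfg
  rw [EventuallyEq.iteratedDeriv_eq n hfg, iteratedDeriv_fun_mul (by fun_prop) hg.contDiffAt]
  simp [hpow]

theorem eventually_sign_eq_sgnAt_mul (hf : AnalyticAt ℝ f a) (hn : analyticOrderAt f a = n) :
    ∀ᶠ x in 𝓝 a, (SignType.sign (f x) : ℤ) = sgnAt f a * (SignType.sign (x - a) : ℤ) ^ n := by
  obtain ⟨g, hg, hga, hfg⟩ := hf.analyticOrderAt_eq_natCast.1 hn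
  have hsgn : sgnAt f a = SignType.sign (g a) := by
    rw [sgnAt_eq_sign_iteratedDeriv hf hn, iteratedDeriv_eq_factorial_mul hg hfg, sign_mul,
      sign_pos (by positivity), one_mul]
  have hconst : ∀ᶠ x in 𝓝 a, SignType.sign (g x) = SignType.sign (g a) :=
    ((continuousAt_sign_of_ne_zero hga).comp hg.continuousAt).eventually_mem
      (IsOpen.mem_nhds (isOpen_discrete {_}) rfl)
  filter_upwards [hfg, hconst] with x hx hgx
  rw [hx, smul_eq_mul, sign_mul, sign_pow, hgx, hsgn, SignType.coe_mul, SignType.coe_pow, mul_comm]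

theorem sgnAt_eq_one_or_neg_one (hf : AnalyticAt ℝ f a) (hn : analyticOrderAt f a = n) :
    sgnAt f a = 1 ∨ sgnAt f a = -1 := by
  have hne := ((analyticOrderAt_eq_nat_iff_iteratedDeriv_eq_zero hf).1 hn).2
  rw [sgnAt_eq_sign_iteratedDeriv hf hn]
  rcases hne.lt_or_gt with h | h <;> simp [h]

theorem even_analyticOrderAt_of_symm (hf : AnalyticAt ℝ f a) (hn : analyticOrderAt f a = n)
    (hsymm : ∀ x, f (2 * a - x) = f x) : Even n := by
  have hne := ((analyticOrderAt_eq_nat_iff_iteratedDeriv_eq_zero hf).1 hn).2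
  have h := congrFun (iteratedDeriv_comp_const_sub n f (2 * a)) a
  rw [funext hsymm, two_mul, add_sub_cancel_right, smul_eq_mul] at h
  by_contra hodd
  rw [Nat.not_even_iff_odd] at hodd
  rw [hodd.neg_one_pow] at h
  exact hne (by linarith)

theorem analyticOrderAt_re_ofReal {F : ℂ → ℂ} (hF : AnalyticAt ℂ F a)
    (hreal : ∀ x : ℝ, ((F x).re : ℂ) = F x) (hn : analyticOrderAt F a = n) :
    analyticOrderAt (fun x : ℝ => (F x).re) a = n := by
  obtain ⟨G, hG, hGa, hFG⟩ := hF.analyticOrderAt_eq_natCast.1 hn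
  have hFG : ∀ᶠ x : ℝ in 𝓝 a, F x = ((x - a) ^ n : ℝ) * G x := by
    filter_upwards [Complex.continuous_ofReal.continuousAt.eventually hFG] with x hx
    rw [hx, smul_eq_mul]
    push_cast
    rfl
  have hG' : ContinuousAt (fun x : ℝ => G x) a :=
    hG.continuousAt.comp_of_eq Complex.continuous_ofReal.continuousAt rfl
  have hGreal : (G a).im = 0 := by
    have hzero : ∀ᶠ x : ℝ in 𝓝[≠] a, (G x).im = 0 := by
      filter_upwards [nhdsWithin_le_nhds hFG, self_mem_nhdsWithin] with x hx hxa
      have him : (F x).im = 0 := by rw [← hreal, Complex.ofReal_im]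
      rw [hx, Complex.im_ofReal_mul, mul_eq_zero] at him
      exact him.resolve_left (pow_ne_zero n (sub_ne_zero.2 hxa))
    exact tendsto_nhds_unique
      ((Complex.continuous_im.continuousAt.comp hG').tendsto.mono_left nhdsWithin_le_nhds)
      (tendsto_const_nhds.congr' (hzero.mono fun _ h => h.symm))
  refine hF.re_ofReal.analyticOrderAt_eq_natCast.2
    ⟨fun x => (G x).re, hG.re_ofReal, fun h => hGa (Complex.ext h hGreal), ?_⟩
  filter_upwards [hFG] with x hx
  rw [hx, Complex.re_ofReal_mul, smul_eq_mul]

theorem analyticOrderAt_polynomial_eval {𝕜 : Type*} [NontriviallyNormedField 𝕜]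
    {p : Polynomial 𝕜} (hp : p ≠ 0) (x : 𝕜) :
    analyticOrderAt (fun y => p.eval y) x = p.rootMultiplicity x := by
  obtain ⟨q, hq, hdvd⟩ := p.exists_eq_pow_rootMultiplicity_mul_and_not_dvd hp x
  rw [(AnalyticOnNhd.eval_polynomial p x (Set.mem_univ x)).analyticOrderAt_eq_natCast]
  refine ⟨fun y => q.eval y, AnalyticOnNhd.eval_polynomial q x (Set.mem_univ x),
    fun h => hdvd (Polynomial.dvd_iff_isRoot.2 h), Eventually.of_forall fun y => ?_⟩
  conv_lhs => rw [hq]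
  simp

end SgnAt

/-! ### The Alexander polynomial and the Hermitian form on the unit circle -/

section Circle

theorem star_eq_inv_of_norm_eq_one {t : ℂ} (ht : ‖t‖ = 1) : star t = t⁻¹ :=
  (Complex.inv_eq_conj ht).symm

theorem norm_circlePoint (φ : ℝ) : ‖circlePoint φ‖ = 1 := Complex.norm_exp_ofReal_mul_I φ

theorem circlePoint_ne_zero (φ : ℝ) : circlePoint φ ≠ 0 := Complex.exp_ne_zero _

theorem continuous_circlePoint : Continuous circlePoint := by
  unfold circlePoint
  fun_prop

theorem circlePoint_two_mul_sub (θ φ : ℝ) :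
    circlePoint (2 * θ - φ) = circlePoint θ ^ 2 * (circlePoint φ)⁻¹ := by
  rw [circlePoint, circlePoint, circlePoint, ← Complex.exp_nat_mul, ← Complex.exp_neg,
    ← Complex.exp_add]
  congr 1
  push_cast
  ring

variable {m : ℕ} (V : Matrix (Fin m) (Fin m) ℤ)

theorem seifertPencil_smul (c a b : ℂ) :
    seifertPencil V (c * a) (c * b) = c • seifertPencil V a b := by
  simp only [seifertPencil, smul_add, smul_smul]

theorem seifertPencil_swap (a b : ℂ) : seifertPencil V b a = (seifertPencil V a b)ᵀ := by
  simp only [seifertPencil, transpose_add, transpose_smul, transpose_transpose, add_comm]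

theorem alexander_inv (hm : Even m) {t : ℂ} (ht : t ≠ 0) : alexander V t⁻¹ = alexander V t := by
  have hpencil : seifertPencil V t⁻¹ (-1) = (-t⁻¹) • (seifertPencil V t (-1))ᵀ := by
    rw [← seifertPencil_swap, ← seifertPencil_smul, neg_mul_neg, mul_one, neg_mul,
      inv_mul_cancel₀ ht]
  obtain ⟨g, rfl⟩ := hm
  have hpow : t⁻¹ ^ (-((g : ℕ) : ℤ)) * t⁻¹ ^ (g + g) = t ^ (-((g : ℕ) : ℤ)) := by
    rw [_root_.inv_zpow', neg_neg, _root_.zpow_neg, zpow_natCast, inv_pow, pow_add]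
    field_simp
  rw [alexander_eq, alexander_eq, hpencil, det_smul, det_transpose, Fintype.card_fin,
    Even.neg_pow ⟨g, rfl⟩, ← mul_assoc, show (g + g) / 2 = g by omega, hpow]

theorem alexander_star (t : ℂ) : alexander V (star t) = star (alexander V t) := by
  have haeval : Polynomial.aeval (star t) (alexanderPoly V) =
      star (Polynomial.aeval t (alexanderPoly V)) :=
    Polynomial.aeval_algHom_apply (starRingEnd ℂ).toIntAlgHom t (alexanderPoly V)
  rw [alexander, alexander, haeval, star_mul', star_zpow₀]

theorem ofReal_re_alexander (hm : Even m) {t : ℂ} (ht : ‖t‖ = 1) :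
    ((alexander V t).re : ℂ) = alexander V t := by
  have h0 : t ≠ 0 := norm_ne_zero_iff.1 (ht ▸ one_ne_zero)
  rw [← Complex.conj_eq_iff_re, starRingEnd_apply, ← alexander_star,
    star_eq_inv_of_norm_eq_one ht, alexander_inv V hm h0]

theorem det_hermitianForm (hm : Even m) {t : ℂ} (ht : ‖t‖ = 1) :
    (hermitianForm V t).det = ((-Complex.normSq (1 - t)) ^ (m / 2) : ℝ) * alexander V t := by
  have h0 : t ≠ 0 := norm_ne_zero_iff.1 (ht ▸ one_ne_zero)
  have hpencil : hermitianForm V t = ((1 - t) * t⁻¹) • seifertPencil V t (-1) := by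
    rw [hermitianForm_eq, star_eq_inv_of_norm_eq_one ht, ← seifertPencil_smul]
    congr 1 <;> field_simp
    ring
  have hsq : ((1 - t) * t⁻¹) ^ 2 = ((-Complex.normSq (1 - t) : ℝ) : ℂ) * t⁻¹ := by
    rw [Complex.ofReal_neg, Complex.normSq_eq_conj_mul_self, starRingEnd_apply, star_sub, star_one,
      star_eq_inv_of_norm_eq_one ht]
    field_simp
    ring
  rw [hpencil, det_smul, Fintype.card_fin, alexander_eq, ← mul_assoc]
  congr 1
  conv_lhs => rw [← Nat.two_mul_div_two_of_even hm]
  rw [pow_mul, hsq, mul_pow, Complex.ofReal_pow, _root_.zpow_neg, zpow_natCast, inv_pow]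

theorem det_hermitianForm_ne_zero (hm : Even m) {t : ℂ} (ht : ‖t‖ = 1) (ht1 : t ≠ 1)
    (h : alexander V t ≠ 0) : (hermitianForm V t).det ≠ 0 := by
  have hnormSq : Complex.normSq (1 - t) ≠ 0 := by
    rwa [Ne, Complex.normSq_eq_zero, sub_eq_zero, eq_comm]
  rw [det_hermitianForm V hm ht]
  exact mul_ne_zero (Complex.ofReal_ne_zero.2 (pow_ne_zero _ (neg_ne_zero.2 hnormSq))) h

theorem sign_det_hermitianForm_mul (U : Matrix (Fin m) (Fin m) ℤ) (hm : Even m) {t : ℂ}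
    (ht : ‖t‖ = 1) (ht1 : t ≠ 1) :
    (SignType.sign (hermitianForm V t).det.re : ℤ) *
        (SignType.sign (hermitianForm U t).det.re : ℤ) =
      (SignType.sign (alexander V t).re : ℤ) * (SignType.sign (alexander U t).re : ℤ) := by
  have hnormSq : -Complex.normSq (1 - t) ≠ 0 := by
    rwa [neg_ne_zero, Ne, Complex.normSq_eq_zero, sub_eq_zero, eq_comm]
  have hsq : 0 < (-Complex.normSq (1 - t)) ^ (m / 2) * (-Complex.normSq (1 - t)) ^ (m / 2) :=
    mul_self_pos.2 (pow_ne_zero _ hnormSq)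
  simp only [← SignType.coe_mul, ← sign_mul, det_hermitianForm _ hm ht, Complex.re_ofReal_mul]
  rw [mul_mul_mul_comm, sign_mul, sign_pos hsq, one_mul]

theorem hermitianForm_add_smul_vecMulVec (s : ℤ) (f : Fin m → ℤ) {t : ℂ} (ht : ‖t‖ = 1) :
    hermitianForm (V + s • vecMulVec f f) t = hermitianForm V t +
      ((s * Complex.normSq (1 - t) : ℝ) : ℂ) •
        vecMulVec (fun i => (f i : ℂ)) (star fun i => (f i : ℂ)) := by
  have h0 : t ≠ 0 := norm_ne_zero_iff.1 (ht ▸ one_ne_zero)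
  have hcoeff : ((s * Complex.normSq (1 - t) : ℝ) : ℂ) = s * ((1 - t) + (1 - star t)) := by
    rw [Complex.ofReal_mul, Complex.normSq_eq_conj_mul_self, starRingEnd_apply, star_sub,
      star_one, star_eq_inv_of_norm_eq_one ht, Complex.ofReal_intCast]
    field_simp
    ring
  have hentry : ∀ i j, (V + s • vecMulVec f f) i j = V i j + s * (f i * f j) := fun _ _ => rfl
  rw [hcoeff]
  ext i j
  simp only [hermitianForm, hentry, Matrix.add_apply, Matrix.smul_apply, map_apply,
    transpose_apply, vecMulVec_apply, Pi.star_apply, star_intCast, smul_eq_mul]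
  push_cast
  ring

theorem signatureAt_eq_add_one_sub {V U : Matrix (Fin m) (Fin m) ℤ} (hm : Even m) {t : ℂ}
    (ht : ‖t‖ = 1) (ht1 : t ≠ 1) (hV : alexander V t ≠ 0) (hU : alexander U t ≠ 0) {s : ℝ}
    (hs : 0 ≤ s) {w : Fin m → ℂ}
    (h : hermitianForm U t = hermitianForm V t + (s : ℂ) • vecMulVec w (star w)) :
    signatureAt U t = signatureAt V t + 1 -
      (SignType.sign (alexander V t).re : ℤ) * (SignType.sign (alexander U t).re : ℤ) := by
  rw [signatureAt_eq, signatureAt_eq, ← sign_det_hermitianForm_mul V U hm ht ht1]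
  exact hermSignature_add_smul_vecMulVec _ _ (det_hermitianForm_ne_zero V hm ht ht1 hV)
    (det_hermitianForm_ne_zero U hm ht ht1 hU) hs h

theorem signatureAt_add_smul_vecMulVec (hm : Even m) (f : Fin m → ℤ) (ε : ℤˣ) {t : ℂ}
    (ht : ‖t‖ = 1) (ht1 : t ≠ 1) (hV : alexander V t ≠ 0)
    (hU : alexander (V + (ε : ℤ) • vecMulVec f f) t ≠ 0) :
    signatureAt (V + (ε : ℤ) • vecMulVec f f) t = signatureAt V t +
      ε * (1 - (SignType.sign (alexander V t).re : ℤ) *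
        (SignType.sign (alexander (V + (ε : ℤ) • vecMulVec f f) t).re : ℤ)) := by
  have hform := hermitianForm_add_smul_vecMulVec V ε f ht
  set U := V + (ε : ℤ) • vecMulVec f f
  have hnormSq := Complex.normSq_nonneg (1 - t)
  rcases Int.units_eq_one_or ε with rfl | rfl
  · rw [Units.val_one, Int.cast_one, one_mul] at hform
    rw [signatureAt_eq_add_one_sub hm ht ht1 hV hU hnormSq hform, Units.val_one]
    ring
  · rw [Units.val_neg, Units.val_one, Int.cast_neg, Int.cast_one, neg_one_mul, Complex.ofReal_neg,
      neg_smul, ← sub_eq_add_neg] at hform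
    rw [signatureAt_eq_add_one_sub hm ht ht1 hU hV hnormSq (eq_add_of_sub_eq hform.symm),
      Units.val_neg, Units.val_one]
    ring

theorem continuous_hermitianForm : Continuous (hermitianForm V) := by
  unfold hermitianForm
  fun_prop

theorem eventually_signatureAt_circlePoint_eq (hm : Even m) {θ : ℝ} (h1 : circlePoint θ ≠ 1)
    (hV : alexander V (circlePoint θ) ≠ 0) :
    ∀ᶠ φ in 𝓝 θ, signatureAt V (circlePoint φ) = signatureAt V (circlePoint θ) :=
  eventually_hermSignature_eq (fun φ => hermitianForm_isHermitian V (circlePoint φ))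
    ((continuous_hermitianForm V).comp continuous_circlePoint).continuousAt
    (det_hermitianForm_ne_zero V hm (norm_circlePoint θ) h1 hV)

theorem alexander_eq_zpow_mul_eval :
    alexander V = id ^ (-((m / 2 : ℕ) : ℤ)) *
      fun z => ((alexanderPoly V).map (Int.castRingHom ℂ)).eval z := by
  funext z
  rw [alexander, Polynomial.aeval_def, Polynomial.eval₂_eq_eval_map]
  rfl

theorem analyticAt_alexander {t : ℂ} (ht : t ≠ 0) : AnalyticAt ℂ (alexander V) t := by
  rw [alexander_eq_zpow_mul_eval]
  exact (analyticAt_id.zpow ht).mul (AnalyticOnNhd.eval_polynomial _ t (Set.mem_univ t))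

theorem analyticOrderAt_alexander {t : ℂ} (ht : t ≠ 0)
    (hp : (alexanderPoly V).map (Int.castRingHom ℂ) ≠ 0) :
    analyticOrderAt (alexander V) t =
      ((alexanderPoly V).map (Int.castRingHom ℂ)).rootMultiplicity t := by
  have hzpow : AnalyticAt ℂ (id ^ (-((m / 2 : ℕ) : ℤ)) : ℂ → ℂ) t := analyticAt_id.zpow ht
  rw [alexander_eq_zpow_mul_eval,
    analyticOrderAt_mul hzpow (AnalyticOnNhd.eval_polynomial _ t (Set.mem_univ t)),
    hzpow.analyticOrderAt_eq_zero.2 (zpow_ne_zero _ ht), zero_add,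
    analyticOrderAt_polynomial_eval hp]

/-- The function `φ ↦ Δ(e^{iφ})` whose sign at `θ` is `alexanderSgn V θ`.  As `Δ` is real on the
unit circle, only the real part is recorded. -/
def alexanderOnCircle : ℝ → ℝ := fun φ => (alexander V (circlePoint φ)).re

theorem alexanderSgn_eq (θ : ℝ) : alexanderSgn V θ = sgnAt (alexanderOnCircle V) θ := rfl

theorem alexanderOnCircle_eq_zero_iff (hm : Even m) {φ : ℝ} :
    alexanderOnCircle V φ = 0 ↔ alexander V (circlePoint φ) = 0 := by
  rw [← ofReal_re_alexander V hm (norm_circlePoint φ), Complex.ofReal_eq_zero, alexanderOnCircle]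

theorem analyticAt_alexander_exp (z : ℂ) :
    AnalyticAt ℂ (alexander V ∘ fun z => Complex.exp (z * Complex.I)) z :=
  (analyticAt_alexander V (Complex.exp_ne_zero _)).comp
    (f := fun z => Complex.exp (z * Complex.I)) (by fun_prop)

theorem analyticAt_alexanderOnCircle (θ : ℝ) : AnalyticAt ℝ (alexanderOnCircle V) θ :=
  (analyticAt_alexander_exp V θ).re_ofReal

theorem analyticOrderAt_alexanderOnCircle (hm : Even m) (θ : ℝ)
    (hp : (alexanderPoly V).map (Int.castRingHom ℂ) ≠ 0) :
    analyticOrderAt (alexanderOnCircle V) θ =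
      ((alexanderPoly V).map (Int.castRingHom ℂ)).rootMultiplicity (circlePoint θ) := by
  have hexp : HasDerivAt (fun z => Complex.exp (z * Complex.I))
      (Complex.exp (θ * Complex.I) * Complex.I) (θ : ℂ) := by
    simpa using ((hasDerivAt_id (θ : ℂ)).mul_const Complex.I).cexp
  have hderiv : deriv (fun z => Complex.exp (z * Complex.I)) (θ : ℂ) ≠ 0 := by
    rw [hexp.deriv]
    exact mul_ne_zero (Complex.exp_ne_zero _) Complex.I_ne_zero
  refine analyticOrderAt_re_ofReal (analyticAt_alexander_exp V θ)
    (fun x => ofReal_re_alexander V hm (norm_circlePoint x)) ?_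
  rw [analyticOrderAt_comp_of_deriv_ne_zero (by fun_prop) hderiv]
  exact analyticOrderAt_alexander V (circlePoint_ne_zero θ) hp

theorem circlePoint_ne_one_of_odd_analyticOrderAt (hm : Even m) {θ : ℝ} {n : ℕ} (hn : Odd n)
    (hord : analyticOrderAt (alexanderOnCircle V) θ = n) : circlePoint θ ≠ 1 := fun h1 => by
  have hsymm (φ : ℝ) : alexanderOnCircle V (2 * θ - φ) = alexanderOnCircle V φ := by
    rw [alexanderOnCircle, alexanderOnCircle, circlePoint_two_mul_sub, h1, one_pow, one_mul,
      alexander_inv V hm (circlePoint_ne_zero φ)]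
  exact Nat.not_even_iff_odd.2 hn
    (even_analyticOrderAt_of_symm (analyticAt_alexanderOnCircle V θ) hord hsymm)

theorem HasJump.of_eventually_eq {σ : ℂ → ℤ} {θ : ℝ} {a b : ℤ}
    (h : ∀ᶠ φ in 𝓝[≠] θ, σ (circlePoint φ) = a + b * (SignType.sign (φ - θ) : ℤ)) :
    HasJump σ θ (2 * b) := by
  refine ⟨a + b, a - b, tendsto_const_nhds.congr' ?_, tendsto_const_nhds.congr' ?_, by ring⟩
  · filter_upwards [nhdsGT_le_nhdsNE θ h, self_mem_nhdsWithin] with φ hφ hlt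
    rw [hφ, sign_pos (sub_pos.2 hlt), SignType.coe_one, mul_one]
  · filter_upwards [nhdsLT_le_nhdsNE θ h, self_mem_nhdsWithin] with φ hφ hlt
    rw [hφ, sign_neg (sub_neg.2 hlt), SignType.coe_neg_one, mul_neg_one, sub_eq_add_neg]

theorem HasJump.congr {σ τ : ℂ → ℤ} {θ : ℝ} {j : ℤ} (hσ : HasJump σ θ j)
    (h : ∀ᶠ φ in 𝓝 θ, σ (circlePoint φ) = τ (circlePoint φ)) : HasJump τ θ j := by
  obtain ⟨a, b, ha, hb, hj⟩ := hσ
  exact ⟨a, b, ha.congr' (nhdsWithin_le_nhds h), hb.congr' (nhdsWithin_le_nhds h), hj⟩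

theorem coe_sign_pow_of_odd (x : ℝ) {n : ℕ} (hn : Odd n) :
    (SignType.sign x : ℤ) ^ n = SignType.sign x := by
  rcases SignType.trichotomy (SignType.sign x) with h | h | h <;>
    simp [h, hn.neg_one_pow, hn.pos.ne']

theorem eventually_alexander_ne_zero (hm : Even m) {θ : ℝ} {n : ℕ}
    (hord : analyticOrderAt (alexanderOnCircle V) θ = n) :
    ∀ᶠ φ in 𝓝[≠] θ, alexander V (circlePoint φ) ≠ 0 := by
  have hanalytic := analyticAt_alexanderOnCircle V θ
  have htop : analyticOrderAt (alexanderOnCircle V) θ ≠ ⊤ := hord ▸ ENat.natCast_ne_top n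
  filter_upwards [hanalytic.eventually_eq_zero_or_eventually_ne_zero.resolve_left
    (mt analyticOrderAt_eq_top.2 htop)] with φ hφ
  exact mt (alexanderOnCircle_eq_zero_iff V hm).2 hφ

theorem analyticOrderAt_alexanderOnCircle_eq_zero (hm : Even m) {θ : ℝ}
    (h : alexander V (circlePoint θ) ≠ 0) : analyticOrderAt (alexanderOnCircle V) θ = (0 : ℕ) :=
  (analyticAt_alexanderOnCircle V θ).analyticOrderAt_eq_zero.2
    (mt (alexanderOnCircle_eq_zero_iff V hm).1 h)

theorem hasJump_signatureAt_of_rank_one (hm : Even m) (f : Fin m → ℤ) (ε : ℤˣ) {θ : ℝ} {n : ℕ}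
    (hn : Odd n) (hord : analyticOrderAt (alexanderOnCircle V) θ = n)
    (hU : alexander (V + (ε : ℤ) • vecMulVec f f) (circlePoint θ) ≠ 0) :
    HasJump (signatureAt V) θ
      (2 * (ε * alexanderSgn V θ * alexanderSgn (V + (ε : ℤ) • vecMulVec f f) θ)) := by
  have hstep := fun t => signatureAt_add_smul_vecMulVec V hm f ε (t := t)
  set U := V + (ε : ℤ) • vecMulVec f f
  have h1 := circlePoint_ne_one_of_odd_analyticOrderAt V hm hn hord
  have hordU := analyticOrderAt_alexanderOnCircle_eq_zero U hm hU
  have hsignV := eventually_sign_eq_sgnAt_mul (analyticAt_alexanderOnCircle V θ) hord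
  have hsignU := eventually_sign_eq_sgnAt_mul (analyticAt_alexanderOnCircle U θ) hordU
  refine HasJump.of_eventually_eq (a := signatureAt U (circlePoint θ) - ε) ?_
  filter_upwards [eventually_alexander_ne_zero V hm hord, eventually_alexander_ne_zero U hm hordU,
    nhdsWithin_le_nhds hsignV, nhdsWithin_le_nhds hsignU,
    nhdsWithin_le_nhds (eventually_signatureAt_circlePoint_eq U hm h1 hU),
    nhdsWithin_le_nhds (continuous_circlePoint.continuousAt.eventually_ne h1)]
    with φ hVφ hUφ hsgnV hsgnU hσ hφ1
  rw [coe_sign_pow_of_odd _ hn, alexanderOnCircle, ← alexanderSgn_eq] at hsgnV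
  rw [pow_zero, mul_one, alexanderOnCircle, ← alexanderSgn_eq] at hsgnU
  have hjump := hstep _ (norm_circlePoint φ) hφ1 hVφ hUφ
  rw [hσ, hsgnV, hsgnU] at hjump
  linear_combination -hjump

end Circle

/-! ### Crossing changes -/

theorem SEquivalent.alexanderOnCircle_eq {m k : ℕ} {V : Matrix (Fin m) (Fin m) ℤ}
    {W : Matrix (Fin k) (Fin k) ℤ} (h : SEquivalent V W) :
    alexanderOnCircle V = alexanderOnCircle W := by
  funext φ
  rw [alexanderOnCircle, alexanderOnCircle, h.alexander_eq (circlePoint_ne_zero φ)]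

theorem SEquivalent.alexanderSgn_eq {m k : ℕ} {V : Matrix (Fin m) (Fin m) ℤ}
    {W : Matrix (Fin k) (Fin k) ℤ} (h : SEquivalent V W) (θ : ℝ) :
    alexanderSgn V θ = alexanderSgn W θ := by
  rw [_root_.alexanderSgn_eq, _root_.alexanderSgn_eq, h.alexanderOnCircle_eq]

theorem SEquivalent.hasJump_signatureAt {m k : ℕ} {V : Matrix (Fin m) (Fin m) ℤ}
    {W : Matrix (Fin k) (Fin k) ℤ} (h : SEquivalent V W) {θ : ℝ} (h1 : circlePoint θ ≠ 1) {j : ℤ}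
    (hV : HasJump (signatureAt V) θ j) : HasJump (signatureAt W) θ j :=
  hV.congr <| (continuous_circlePoint.continuousAt.eventually_ne h1).mono
    fun _ hφ => h.signatureAt_eq hφ

theorem alexanderSgn_eq_one_or_neg_one {m : ℕ} {V : Matrix (Fin m) (Fin m) ℤ} {θ : ℝ} {n : ℕ}
    (hord : analyticOrderAt (alexanderOnCircle V) θ = n) :
    alexanderSgn V θ = 1 ∨ alexanderSgn V θ = -1 :=
  sgnAt_eq_one_or_neg_one (analyticAt_alexanderOnCircle V θ) hord

theorem hasJump_signatureAt_of_sEquivalent_rank_one {n m k : ℕ} {V₀ : Matrix (Fin n) (Fin n) ℤ}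
    {V : Matrix (Fin m) (Fin m) ℤ} {W : Matrix (Fin k) (Fin k) ℤ} {f : Fin n → ℤ} {ε : ℤˣ}
    (hn : Even n) (hV : SEquivalent V₀ V)
    (hW : SEquivalent (V₀ + (ε : ℤ) • vecMulVec f f) W) {θ : ℝ}
    (hodd : Odd (((alexanderPoly V).map (Int.castRingHom ℂ)).rootMultiplicity (circlePoint θ)))
    (hgood : alexander W (circlePoint θ) ≠ 0) :
    HasJump (signatureAt V) θ (2 * (ε * alexanderSgn V θ * alexanderSgn W θ)) ∧
      2 * (ε * alexanderSgn V θ * alexanderSgn W θ) ∈ ({-2, 2} : Set ℤ) := by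
  have hpoly : (alexanderPoly V).map (Int.castRingHom ℂ) ≠ 0 := fun h => by
    simp [h, Polynomial.rootMultiplicity_zero] at hodd
  have hordV := analyticOrderAt_alexanderOnCircle V (hV.even_iff.1 hn) θ hpoly
  have hordW := analyticOrderAt_alexanderOnCircle_eq_zero W (hW.even_iff.1 hn) hgood
  have h1 := circlePoint_ne_one_of_odd_analyticOrderAt V (hV.even_iff.1 hn) hodd hordV
  constructor
  · rw [← hV.alexanderSgn_eq, ← hW.alexanderSgn_eq]
    rw [← hV.alexanderOnCircle_eq] at hordV
    rw [← hW.alexander_eq (circlePoint_ne_zero θ)] at hgood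
    exact hV.hasJump_signatureAt h1 (hasJump_signatureAt_of_rank_one V₀ hn f ε hodd hordV hgood)
  · rcases Int.units_eq_one_or ε with h | h <;>
    rcases alexanderSgn_eq_one_or_neg_one hordV with hV | hV <;>
    rcases alexanderSgn_eq_one_or_neg_one hordW with hW | hW <;>
    simp [h, hV, hW]

theorem KnotDiagram.IsSeifertMatrix.sEquivalent {D : KnotDiagram} {m k : ℕ}
    {V : Matrix (Fin m) (Fin m) ℤ} {W : Matrix (Fin k) (Fin k) ℤ} (hV : D.IsSeifertMatrix V)
    (hW : D.IsSeifertMatrix W) : SEquivalent V W := by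
  obtain ⟨_, V₀, hV₀, hVV⟩ := hV
  obtain ⟨_, W₀, hW₀, hWW⟩ := hW
  exact hVV.symm.trans ((hV₀.sEquivalent hW₀).trans hWW)

theorem KnotDiagram.IsSeifertMatrix.exists_rank_one_of_resolve_neg {D : KnotDiagram} {m k : ℕ}
    {V : Matrix (Fin m) (Fin m) ℤ} {W : Matrix (Fin k) (Fin k) ℤ} (hV : D.IsSeifertMatrix V)
    {c : Fin D.n} (hW : (D.resolve c (-D.sign c)).IsSeifertMatrix W) :
    ∃ (n : ℕ) (V₀ : Matrix (Fin n) (Fin n) ℤ) (f : Fin n → ℤ), Even n ∧ SEquivalent V₀ V ∧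
      SEquivalent (V₀ + (D.sign c : ℤ) • vecMulVec f f) W := by
  obtain ⟨n, V₀, hV₀, hVV⟩ := hV
  obtain ⟨_, W₀, hW₀, hWW⟩ := hW
  obtain ⟨f, hf⟩ := hV₀.exists_resolve_neg c
  exact ⟨n, V₀, f, hV₀.even, hVV, (hf.sEquivalent hW₀).trans hWW⟩

theorem apply_one_mul_apply_neg_one {A : Type*} [CommMonoid A] (g : ℤˣ → A) (ε : ℤˣ) :
    g 1 * g (-1) = g ε * g (-ε) := by
  rcases Int.units_eq_one_or ε with rfl | rfl
  · rfl
  · rw [neg_neg, mul_comm]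

theorem HasSimpleCircleRoots.rootMultiplicity_eq_one {m : ℕ} {V : Matrix (Fin m) (Fin m) ℤ}
    (h : HasSimpleCircleRoots V) {ρ : ℂ} (hρ : ‖ρ‖ = 1) (hroot : alexander V ρ = 0) :
    ((alexanderPoly V).map (Int.castRingHom ℂ)).rootMultiplicity ρ = 1 := by
  have hρ0 : ρ ≠ 0 := norm_ne_zero_iff.1 (hρ ▸ one_ne_zero)
  have haeval (p : Polynomial ℤ) : Polynomial.aeval ρ p = (p.map (Int.castRingHom ℂ)).eval ρ :=
    Polynomial.eval₂_eq_eval_map _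
  have hzero : Polynomial.aeval ρ (alexanderPoly V) = 0 :=
    (mul_eq_zero.1 hroot).resolve_left (zpow_ne_zero _ hρ0)
  have hderiv := h ρ hρ hzero
  rw [haeval] at hzero
  rw [haeval, ← Polynomial.derivative_map] at hderiv
  have hpoly : (alexanderPoly V).map (Int.castRingHom ℂ) ≠ 0 := fun h0 => hderiv (by simp [h0])
  refine le_antisymm (not_lt.1 fun hlt => ?_) ((Polynomial.rootMultiplicity_pos hpoly).2 hzero)
  exact hderiv ((Polynomial.one_lt_rootMultiplicity_iff_isRoot hpoly).1 hlt).2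

theorem theorem2p6_general (D : KnotDiagram) (c : Fin D.n)
    (m : ℕ) (V : Matrix (Fin m) (Fin m) ℤ) (hV : D.IsSeifertMatrix V)
    (k : ℤˣ → ℕ) (W : (δ : ℤˣ) → Matrix (Fin (k δ)) (Fin (k δ)) ℤ)
    (hW : ∀ δ : ℤˣ, (D.resolve c δ).IsSeifertMatrix (W δ)) (θ : ℝ)
    (hodd : Odd (((alexanderPoly V).map (Int.castRingHom ℂ)).rootMultiplicity (circlePoint θ)))
    (hgood : alexander (W (-D.sign c)) (circlePoint θ) ≠ 0) :
    HasJump (signatureAt V) θ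
        (2 * (D.sign c : ℤ) * alexanderSgn (W 1) θ * alexanderSgn (W (-1)) θ) ∧
      2 * (D.sign c : ℤ) * alexanderSgn (W 1) θ * alexanderSgn (W (-1)) θ ∈ ({-2, 2} : Set ℤ) := by
  obtain ⟨n, V₀, f, hn, hV₀, hU⟩ := hV.exists_rank_one_of_resolve_neg (hW (-D.sign c))
  have hself := hW (D.sign c)
  rw [D.resolve_sign] at hself
  have hsgn : 2 * (D.sign c : ℤ) * alexanderSgn (W 1) θ * alexanderSgn (W (-1)) θ =
      2 * (D.sign c * alexanderSgn V θ * alexanderSgn (W (-D.sign c)) θ) := by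
    rw [hV.sEquivalent hself |>.alexanderSgn_eq]
    linear_combination
      2 * (D.sign c : ℤ) * apply_one_mul_apply_neg_one (fun δ => alexanderSgn (W δ) θ) (D.sign c)
  rw [hsgn]
  exact hasJump_signatureAt_of_sEquivalent_rank_one hn hV₀ hU hodd hgood

end

theorem theorem2p6 (D : KnotDiagram) (c : Fin D.n)
    (m : ℕ) (V : Matrix (Fin m) (Fin m) ℤ) (hV : D.IsSeifertMatrix V)
    (k : ℤˣ → ℕ) (W : (δ : ℤˣ) → Matrix (Fin (k δ)) (Fin (k δ)) ℤ)
    (hW : ∀ δ : ℤˣ, (D.resolve c δ).IsSeifertMatrix (W δ))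
    (hsimple : HasSimpleCircleRoots V)
    (θ : ℝ) (hroot : alexander V (circlePoint θ) = 0)
    (hgood : alexander (W (-D.sign c)) (circlePoint θ) ≠ 0) :
    HasJump (signatureAt V) θ
        (2 * (D.sign c : ℤ) * alexanderSgn (W 1) θ * alexanderSgn (W (-1)) θ) ∧
      2 * (D.sign c : ℤ) * alexanderSgn (W 1) θ * alexanderSgn (W (-1)) θ ∈ ({-2, 2} : Set ℤ) :=
  theorem2p6_general D c m V hV k W hW θ
    ((hsimple.rootMultiplicity_eq_one (norm_circlePoint θ) hroot).symm ▸ odd_one) hgood
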